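/- Let $\mathscr{C}$ be a symmetric monoidal category with tensor unit $I$. The category $\mathbf{Learn}_{\mathscr{C}}$ has as objects the pairs $(A,A')$ of objects of $\mathscr{C}$, and its morphisms are the elements of $$\mathbf{Learn}_{\mathscr{C}}((A,A'),(B,B')) = \int^{P,Q:\mathscr{C}} \mathscr{C}(P\otimes A, Q\otimes B)\times\mathscr{C}(Q\otimes B', P\otimes A'),$$ where the class of a pair $(l,r)$ is written $(l\mid r)$. The identity of $(A,A')$ is $(\mathrm{id}_{I\otimes A}\mid \mathrm{id}_{I\otimes A'})$. The composite of $(l_1\mid r_1):(A,A')\to(B,B')$ and $(l_2\mid r_2):(B,B')\to(C,C')$ has parameters $P_2\otimes P_1$ and $Q_1\otimes Q_2$; up to symmetries of $\mathscr{C}$, its left component is $l_1$ followed by $l_2$, and its right component is $r_2$ followed by $r_1$. It is a symmetric monoidal category with $(A,A')\otimes(B,B') = (A\otimes B, B'\otimes A')$ and unit $(I,I)$; the tensor product of morphisms places the components side by side (moving the parameter wires to the left by symmetries), and the structure isomorphisms are induced from those of $\mathscr{C}$. Put $(A,A')^* = (A',A)$ and $(l\mid r)^*=(r\mid l)$. For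 $X=(A,A')$ let $\eta_X:(I,I)\to X\otimes X^*$ be the learner with $P=A\otimes A'$, $Q=I$, and let $\varepsilon_X:X^*\otimes X\to(I,I)$ be the learner with $P=I$, $Q=A'\otimes A$, all components being the canonical isomorphisms of $\mathscr{C}$ given by the unit constraints. Let $\mathbf{Atemp}_{\mathscr{C}}$ be the quotient of $\mathbf{Learn}_{\mathscr{C}}$, as a symmetric monoidal category, by the smallest congruence (compatible with composition and tensor product) which, for every object $X$, identifies the snake $$X\to (X\otimes X^*)\otimes X\to X\otimes (X^*\otimes X)\to X$$ built from $\eta_X$ and $\varepsilon_X$ with $\mathrm{id}_X$. Then $\mathbf{Atemp}_{\mathscr{C}}$ is compact closed: every object has a left and a right dual. More precisely, for every $X=(A,A')$ the morphisms $\eta_X$ and $\varepsilon_X$ satisfy both snake equations in $\mathbf{Atemp}_{\mathscr{C}}$, so that they exhibit $X^*=(A',A)$ as a dual of $X$; and they are extranatural with respect to all morphisms, that is, for every learner $f:X\to Y$ one has in $\mathbf{Atemp}_{\mathscr{C}}$ $$(f\otimes \mathrm{id}_{X^*})\circ\eta_X = (\mathrm{id}_Y\otimes f^*)\circ\eta_Y,\qquad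 \varepsilon_X\circ(f^*\otimes\mathrm{id}_X)=\varepsilon_Y\circ(\mathrm{id}_{Y^*}\otimes f).$$ -/

import Mathlib

set_option linter.unusedSectionVars false

open CategoryTheory MonoidalCategory BraidedCategory

universe v u

/-! ### Parametrised morphisms `P ⊗ A ⟶ Q ⊗ B` in a symmetric monoidal category -/

namespace Learner
variable {C : Type u} [Category.{v} C] [MonoidalCategory C] [SymmetricCategory C]

/-- The symmetry exchanging the two outer wires in `P ⊗ (X ⊗ A)`. -/
def exch (P X A : C) : P ⊗ (X ⊗ A) ⟶ X ⊗ (P ⊗ A) :=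
  (α_ P X A).inv ≫ (β_ P X).hom ▷ A ≫ (α_ X P A).hom

theorem exch_exch (P X A : C) : exch P X A ≫ exch X P A = 𝟙 _ := by
  simp [exch, ← comp_whiskerRight_assoc]

theorem exch_nat_left {P P' : C} (p : P ⟶ P') (X A : C) :
    p ▷ (X ⊗ A) ≫ exch P' X A = exch P X A ≫ X ◁ (p ▷ A) := by
  simp only [exch, Category.assoc, associator_inv_naturality_left_assoc,
    ← comp_whiskerRight_assoc, braiding_naturality_left]
  simp

theorem exch_nat_mid (P : C) {X X' : C} (x : X ⟶ X') (A : C) :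
    P ◁ (x ▷ A) ≫ exch P X' A = exch P X A ≫ x ▷ (P ⊗ A) := by
  simp only [exch, Category.assoc, associator_inv_naturality_middle_assoc,
    ← comp_whiskerRight_assoc, braiding_naturality_right]
  simp

theorem exch_nat_right (P X : C) {A A' : C} (a : A ⟶ A') :
    P ◁ (X ◁ a) ≫ exch P X A' = exch P X A ≫ X ◁ (P ◁ a) := by
  simp only [exch, Category.assoc, associator_inv_naturality_right_assoc, whisker_exchange_assoc,
     ← associator_naturality_right]

theorem exch_tensor_left (P R X A : C) :
    exch (P ⊗ R) X A =
      (α_ P R (X ⊗ A)).hom ≫ P ◁ exch R X A ≫ exch P X (R ⊗ A) ≫ X ◁ (α_ P R A).inv := by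
  simp [exch]

theorem exch_tensor_mid (P X Y A : C) :
    exch P (X ⊗ Y) A =
      P ◁ (α_ X Y A).hom ≫ exch P X (Y ⊗ A) ≫ X ◁ exch P Y A ≫ (α_ X Y (P ⊗ A)).inv := by
  simp [exch]

theorem exch_tensor_right (P X A B : C) :
    exch P X (A ⊗ B) =
      P ◁ (α_ X A B).inv ≫ (α_ P (X ⊗ A) B).inv ≫ exch P X A ▷ B ≫ (α_ X (P ⊗ A) B).hom ≫
        X ◁ (α_ P A B).hom := by
  simp [exch]

theorem exch_unit_left (X A : C) : exch (𝟙_ C) X A = (λ_ (X ⊗ A)).hom ≫ X ◁ (λ_ A).inv := by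
  simp [exch]

theorem exch_unit_mid (P A : C) : exch P (𝟙_ C) A = P ◁ (λ_ A).hom ≫ (λ_ (P ⊗ A)).inv := by
  simp [exch]

theorem exch_yang_baxter (P X Y A : C) :
    P ◁ exch X Y A ≫ exch P Y (X ⊗ A) ≫ Y ◁ exch P X A =
      exch P X (Y ⊗ A) ≫ X ◁ exch P Y A ≫ exch X Y (P ⊗ A) := by
  have h := congrArg (fun t => P ◁ (α_ X Y A).inv ≫ (α_ P (X ⊗ Y) A).inv ≫ t ▷ A ≫
    (α_ Y (X ⊗ P) A).hom ≫ Y ◁ (α_ X P A).hom) (yang_baxter P X Y)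
  simp only [exch]
  refine Eq.trans ?_ (h.symm.trans ?_) <;> monoidal

/-- Sequential composite of `f : P₁ ⊗ X ⟶ Q₁ ⊗ Y` and `g : P₂ ⊗ Y ⟶ Q₂ ⊗ Z`, with parameter wires
`P₂ ⊗ P₁` and `Q₁ ⊗ Q₂`: apply `f` on `P₁, X`, let `P₂` and `Q₁` cross, apply `g` on `P₂, Y`. -/
def pcomp {P₁ Q₁ P₂ Q₂ X Y Z : C} (f : P₁ ⊗ X ⟶ Q₁ ⊗ Y) (g : P₂ ⊗ Y ⟶ Q₂ ⊗ Z) :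
    (P₂ ⊗ P₁) ⊗ X ⟶ (Q₁ ⊗ Q₂) ⊗ Z :=
  (α_ P₂ P₁ X).hom ≫ P₂ ◁ f ≫ exch P₂ Q₁ Y ≫ Q₁ ◁ g ≫ (α_ Q₁ Q₂ Z).inv

/-- `f` placed next to an identity wire `X` on its left; the parameter wires cross `X`. -/
def wl (X : C) {P Q A B : C} (f : P ⊗ A ⟶ Q ⊗ B) : P ⊗ (X ⊗ A) ⟶ Q ⊗ (X ⊗ B) :=
  exch P X A ≫ X ◁ f ≫ exch X Q B

/-- `f` placed next to an identity wire `Y` on its right. -/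
def wr {P Q A B : C} (f : P ⊗ A ⟶ Q ⊗ B) (Y : C) : P ⊗ (A ⊗ Y) ⟶ Q ⊗ (B ⊗ Y) :=
  (α_ P A Y).inv ≫ f ▷ Y ≫ (α_ Q B Y).hom

theorem pcomp_nat {P₁ Q₁ P₂ Q₂ X Y Z P₁' P₂' Q₁' Q₂' : C}
    (f : P₁ ⊗ X ⟶ Q₁ ⊗ Y) (g : P₂ ⊗ Y ⟶ Q₂ ⊗ Z)
    (p₁ : P₁' ⟶ P₁) (q₁ : Q₁ ⟶ Q₁') (p₂ : P₂' ⟶ P₂) (q₂ : Q₂ ⟶ Q₂') :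
    pcomp (p₁ ▷ X ≫ f ≫ q₁ ▷ Y) (p₂ ▷ Y ≫ g ≫ q₂ ▷ Z) =
      (p₂ ⊗ₘ p₁) ▷ X ≫ pcomp f g ≫ (q₁ ⊗ₘ q₂) ▷ Z := by
  simp only [pcomp, whiskerLeft_comp, Category.assoc, MonoidalCategory.tensorHom_def,
    comp_whiskerRight]
  rw [reassoc_of% (exch_nat_mid P₂' q₁ Y), ← whisker_exchange_assoc q₁,
    ← reassoc_of% (exch_nat_left p₂ Q₁ Y), ← whisker_exchange_assoc q₁ g,
    whisker_exchange_assoc p₂ f, whisker_exchange_assoc p₂ (p₁ ▷ X)]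
  simp

theorem wl_nat (X : C) {P Q A B P' Q' : C} (f : P ⊗ A ⟶ Q ⊗ B) (p : P' ⟶ P) (q : Q ⟶ Q') :
    wl X (p ▷ A ≫ f ≫ q ▷ B) = p ▷ (X ⊗ A) ≫ wl X f ≫ q ▷ (X ⊗ B) := by
  simp only [wl, whiskerLeft_comp, Category.assoc, exch_nat_mid]
  rw [← Category.assoc, ← exch_nat_left]
  simp only [Category.assoc]

theorem wr_nat {P Q A B P' Q' : C} (f : P ⊗ A ⟶ Q ⊗ B) (p : P' ⟶ P) (q : Q ⟶ Q') (Y : C) :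
    wr (p ▷ A ≫ f ≫ q ▷ B) Y = p ▷ (A ⊗ Y) ≫ wr f Y ≫ q ▷ (B ⊗ Y) := by
  simp [wr]

theorem wl_pcomp (W : C) {P₁ Q₁ P₂ Q₂ X Y Z : C} (f : P₁ ⊗ X ⟶ Q₁ ⊗ Y) (g : P₂ ⊗ Y ⟶ Q₂ ⊗ Z) :
    wl W (pcomp f g) = pcomp (wl W f) (wl W g) := by
  simp only [pcomp, wl, whiskerLeft_comp, Category.assoc, exch_tensor_left, exch_tensor_mid]
  rw [reassoc_of% (exch_yang_baxter P₂ W Q₁ Y)]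
  rw [← reassoc_of% (exch_nat_right W Q₁ g)]
  rw [reassoc_of% (exch_nat_right P₂ W f)]
  simp

theorem wr_pcomp (W : C) {P₁ Q₁ P₂ Q₂ X Y Z : C} (f : P₁ ⊗ X ⟶ Q₁ ⊗ Y) (g : P₂ ⊗ Y ⟶ Q₂ ⊗ Z) :
    wr (pcomp f g) W = pcomp (wr f W) (wr g W) := by
  simp [pcomp, wr, exch_tensor_right]

theorem pcomp_assoc {P₁ Q₁ P₂ Q₂ P₃ Q₃ X Y Z W : C} (f : P₁ ⊗ X ⟶ Q₁ ⊗ Y)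
    (g : P₂ ⊗ Y ⟶ Q₂ ⊗ Z) (h : P₃ ⊗ Z ⟶ Q₃ ⊗ W) :
    pcomp f (pcomp g h) =
      (α_ P₃ P₂ P₁).hom ▷ X ≫ pcomp (pcomp f g) h ≫ (α_ Q₁ Q₂ Q₃).hom ▷ W := by
  simp only [pcomp, whiskerLeft_comp, Category.assoc, exch_tensor_left, exch_tensor_mid,
    whiskerLeft_inv_hom_assoc]
  rw [← reassoc_of% (exch_nat_right P₃ Q₁ g)]
  simp

theorem pcomp_exchange {P Q A B R S X Y : C} (f : P ⊗ A ⟶ Q ⊗ B) (g : R ⊗ X ⟶ S ⊗ Y) :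
    (β_ R P).hom ▷ (A ⊗ X) ≫ pcomp (wl A g) (wr f Y) ≫ (β_ S Q).hom ▷ (B ⊗ Y) =
      pcomp (wr f X) (wl B g) := by
  have h1 : P ◁ exch A S Y ≫ exch P S (A ⊗ Y) ≫ S ◁ (α_ P A Y).inv =
      (α_ P A (S ⊗ Y)).inv ≫ exch (P ⊗ A) S Y := by simp [exch_tensor_left]
  have h2 : exch Q S (B ⊗ Y) ≫ (α_ S Q (B ⊗ Y)).inv ≫ (β_ S Q).hom ▷ (B ⊗ Y) =
      (α_ Q S (B ⊗ Y)).inv := by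
    simp only [exch, Category.assoc, Iso.hom_inv_id_assoc, ← comp_whiskerRight,
      SymmetricCategory.symmetry, id_whiskerRight, Category.comp_id]
  have h3 : R ◁ (α_ Q B X).hom ≫ exch R Q (B ⊗ X) ≫ Q ◁ exch R B X =
      exch R (Q ⊗ B) X ≫ (α_ Q B (R ⊗ X)).hom := by simp [exch_tensor_mid]
  have h4 : (α_ R P (A ⊗ X)).hom ≫ exch R P (A ⊗ X) =
      (β_ R P).hom ▷ (A ⊗ X) ≫ (α_ P R (A ⊗ X)).hom := by simp [exch]
  have h5 : P ◁ A ◁ g ≫ (α_ P A (S ⊗ Y)).inv ≫ f ▷ (S ⊗ Y) =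
      (α_ P A (R ⊗ X)).inv ≫ f ▷ (R ⊗ X) ≫ (α_ Q B (R ⊗ X)).hom ≫ Q ◁ B ◁ g ≫
        (α_ Q B (S ⊗ Y)).inv := by
    rw [associator_inv_naturality_right_assoc, whisker_exchange]
    simp
  simp only [pcomp, wl, wr, whiskerLeft_comp, Category.assoc]
  rw [reassoc_of% h1, reassoc_of% h3]
  rw [← reassoc_of% (exch_nat_left f S Y), reassoc_of% (exch_nat_mid R f X)]
  rw [exch_tensor_left Q B, exch_tensor_mid R P A]
  simp only [Category.assoc, whiskerLeft_inv_hom_assoc]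
  rw [h2, reassoc_of% h4, reassoc_of% h5]
  simp

theorem pcomp_pure_left {P Q X Y Z : C} (a : X ⟶ Y) (g : P ⊗ Y ⟶ Q ⊗ Z) :
    pcomp (𝟙_ C ◁ a) g = (ρ_ P).hom ▷ X ≫ (P ◁ a ≫ g) ≫ (λ_ Q).inv ▷ Z := by
  simp [pcomp, exch_unit_mid]

theorem pcomp_pure_right {P Q X Y Z : C} (f : P ⊗ X ⟶ Q ⊗ Y) (b : Y ⟶ Z) :
    pcomp f (𝟙_ C ◁ b) = (λ_ P).hom ▷ X ≫ (f ≫ Q ◁ b) ≫ (ρ_ Q).inv ▷ Z := by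
  simp [pcomp, exch_unit_left]

theorem wl_pure (X : C) {A B : C} (a : A ⟶ B) : wl X (𝟙_ C ◁ a) = 𝟙_ C ◁ (X ◁ a) := by
  simp only [wl, exch_nat_right]
  rw [reassoc_of% (exch_exch (𝟙_ C) X A)]

theorem wr_pure {A B : C} (a : A ⟶ B) (Y : C) : wr (𝟙_ C ◁ a) Y = 𝟙_ C ◁ (a ▷ Y) := by
  simp [wr]

theorem wl_tensor (X Y : C) {P Q A B : C} (f : P ⊗ A ⟶ Q ⊗ B) :
    wl (X ⊗ Y) f ≫ Q ◁ (α_ X Y B).hom = P ◁ (α_ X Y A).hom ≫ wl X (wl Y f) := by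
  have h : exch (X ⊗ Y) Q B ≫ Q ◁ (α_ X Y B).hom =
      (α_ X Y (Q ⊗ B)).hom ≫ X ◁ exch Y Q B ≫ exch X Q (Y ⊗ B) := by simp [exch_tensor_left]
  simp only [wl, Category.assoc, h, whiskerLeft_comp, exch_tensor_mid]
  simp

theorem wr_tensor {P Q A B : C} (f : P ⊗ A ⟶ Q ⊗ B) (Y Z : C) :
    P ◁ (α_ A Y Z).hom ≫ wr f (Y ⊗ Z) = wr (wr f Y) Z ≫ Q ◁ (α_ B Y Z).hom := by
  simp [wr]

theorem wr_wl (X : C) {P Q A B : C} (f : P ⊗ A ⟶ Q ⊗ B) (Z : C) :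
    wr (wl X f) Z ≫ Q ◁ (α_ X B Z).hom = P ◁ (α_ X A Z).hom ≫ wl X (wr f Z) := by
  simp [wl, wr, exch_tensor_right]

theorem wl_unit {P Q A B : C} (f : P ⊗ A ⟶ Q ⊗ B) :
    wl (𝟙_ C) f ≫ Q ◁ (λ_ B).hom = P ◁ (λ_ A).hom ≫ f := by
  simp [wl, exch_unit_left, exch_unit_mid]

theorem wr_unit {P Q A B : C} (f : P ⊗ A ⟶ Q ⊗ B) :
    wr f (𝟙_ C) ≫ Q ◁ (ρ_ B).hom = P ◁ (ρ_ A).hom ≫ f := by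
  simp [wr]

theorem wr_braid {P Q A B : C} (f : P ⊗ A ⟶ Q ⊗ B) (Z : C) :
    wr f Z ≫ Q ◁ (β_ B Z).hom = P ◁ (β_ A Z).hom ≫ wl Z f := by
  have h1 : P ◁ (β_ A Z).hom ≫ exch P Z A = (α_ P A Z).inv ≫ (β_ (P ⊗ A) Z).hom := by
    simp [exch]
  have h2 : (β_ (Q ⊗ B) Z).hom ≫ exch Z Q B = (α_ Q B Z).hom ≫ Q ◁ (β_ B Z).hom := by
    have := reassoc_of% (exch_exch Q Z B)
    simp only [braiding_tensor_left_hom, Category.assoc]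
    simp only [exch, Category.assoc, Iso.hom_inv_id_assoc] at this ⊢
    simp [← comp_whiskerRight_assoc]
  simp only [wl, wr, Category.assoc]
  rw [reassoc_of% h1, ← braiding_naturality_left_assoc, h2]

theorem wl_braid (Z : C) {P Q A B : C} (f : P ⊗ A ⟶ Q ⊗ B) :
    wl Z f ≫ Q ◁ (β_ Z B).hom = P ◁ (β_ Z A).hom ≫ wr f Z := by
  rw [← cancel_epi (P ◁ (β_ A Z).hom), ← reassoc_of% (wr_braid f Z)]
  simp only [← whiskerLeft_comp, ← whiskerLeft_comp_assoc, SymmetricCategory.symmetry,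
    whiskerLeft_id, Category.comp_id, Category.id_comp]

theorem hexagon_snd_forward (X Y Z : C) :
    ((α_ X Z Y).hom ≫ (β_ X (Z ⊗ Y)).hom) ≫ (α_ Z Y X).hom =
      ((β_ X Z).hom ▷ Y ≫ (α_ Z X Y).hom) ≫ Z ◁ (β_ X Y).hom := by
  simp

theorem hexagon_snd_reverse (X Y Z : C) :
    ((α_ Y X Z).inv ≫ (β_ (Y ⊗ X) Z).hom) ≫ (α_ Z Y X).inv =
      (Y ◁ (β_ X Z).hom ≫ (α_ Y Z X).inv) ≫ (β_ Y Z).hom ▷ X := by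
  simp

end Learner

/-! ### The category of learners -/

/-- An object `(A, A')` of the category of learners on `C`: a pair of objects of `C`. -/
structure Learn (C : Type u) where
  fst : C
  snd : C

namespace Learn

section Defs

variable {C : Type u} [Category.{v} C] [MonoidalCategory C]

/-- A pair of maps `l : P ⊗ A ⟶ Q ⊗ B` and `r : Q ⊗ B' ⟶ P ⊗ A'` representing a learner
`(A, A') ⟶ (B, B')`. -/
structure Rep (X Y : Learn C) where
  P : C
  Q : C
  l : P ⊗ X.fst ⟶ Q ⊗ Y.fst
  r : Q ⊗ Y.snd ⟶ P ⊗ X.snd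

/-- The relation generating the coend
`∫^{P, Q} C(P ⊗ A, Q ⊗ B) × C(Q ⊗ B', P ⊗ A')`: maps `p : P ⟶ P'` and `q : Q' ⟶ Q` may be moved
from one component to the other. -/
inductive Rel {X Y : Learn C} : Rep X Y → Rep X Y → Prop
  | slide {P P' Q Q' : C} (p : P ⟶ P') (q : Q' ⟶ Q)
      (l : P' ⊗ X.fst ⟶ Q' ⊗ Y.fst) (r : Q ⊗ Y.snd ⟶ P ⊗ X.snd) :
      Rel ⟨P, Q, p ▷ X.fst ≫ l ≫ q ▷ Y.fst, r⟩ ⟨P', Q', l, q ▷ Y.snd ≫ r ≫ p ▷ X.snd⟩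

/-- Learners `X ⟶ Y`: elements of the coend
`∫^{P, Q} C(P ⊗ A, Q ⊗ B) × C(Q ⊗ B', P ⊗ A')` of sets, i.e. the quotient of the set of all
representatives by the equivalence relation generated by `Rel`. -/
def Hom (X Y : Learn C) : Type (max u v) := Quot (@Rel C _ _ X Y)

/-- The learner `(l | r)`. -/
def ofPair {X Y : Learn C} {P Q : C} (l : P ⊗ X.fst ⟶ Q ⊗ Y.fst) (r : Q ⊗ Y.snd ⟶ P ⊗ X.snd) :
    Hom X Y := Quot.mk _ ⟨P, Q, l, r⟩

theorem ofPair_eq {X Y : Learn C} {P P' Q Q' : C} {l : P ⊗ X.fst ⟶ Q ⊗ Y.fst}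
    {r : Q ⊗ Y.snd ⟶ P ⊗ X.snd} {l' : P' ⊗ X.fst ⟶ Q' ⊗ Y.fst} {r' : Q' ⊗ Y.snd ⟶ P' ⊗ X.snd}
    (p : P ⟶ P') (q : Q' ⟶ Q) (hl : l = p ▷ X.fst ≫ l' ≫ q ▷ Y.fst)
    (hr : r' = q ▷ Y.snd ≫ r ≫ p ▷ X.snd) : ofPair l r = ofPair l' r' := by
  subst hl hr
  exact Quot.sound (Rel.slide p q l' r)

theorem ind {X Y : Learn C} {motive : Hom X Y → Prop}
    (h : ∀ (P Q : C) (l : P ⊗ X.fst ⟶ Q ⊗ Y.fst) (r : Q ⊗ Y.snd ⟶ P ⊗ X.snd), motive (ofPair l r))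
    (f : Hom X Y) : motive f := by
  obtain ⟨P, Q, l, r⟩ := f
  exact h P Q l r

/-- The dual object `(A, A')^* = (A', A)`. -/
def dual (X : Learn C) : Learn C := ⟨X.snd, X.fst⟩

/-- The involution `(l | r)^* = (r | l)`. -/
def Hom.dual {X Y : Learn C} : Hom X Y → Hom Y.dual X.dual :=
  Quot.lift (fun x => ofPair (X := Y.dual) (Y := X.dual) x.r x.l) (by
    rintro _ _ ⟨p, q, l, r⟩
    exact (ofPair_eq (X := Y.dual) (Y := X.dual) q p rfl rfl).symm)

end Defs

variable {C : Type u} [Category.{v} C] [MonoidalCategory C] [SymmetricCategory C]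

open Learner

/-- Composition of `(l₁ | r₁)` and `(l₂ | r₂)`. The parameter objects are `P₂ ⊗ P₁` and `Q₁ ⊗ Q₂`;
in the coend their order is immaterial, because the symmetry may be slid across. -/
def Hom.comp {X Y Z : Learn C} : Hom X Y → Hom Y Z → Hom X Z :=
  Quot.lift₂ (fun x y => ofPair (pcomp x.l y.l) (pcomp y.r x.r))
    (by
      rintro x _ _ ⟨p, q, l, r⟩
      have h1 := pcomp_nat x.l l (𝟙 _) (𝟙 _) p q
      have h2 := pcomp_nat r x.r q p (𝟙 _) (𝟙 _)
      simp only [id_whiskerRight, Category.id_comp, Category.comp_id] at h1 h2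
      exact ofPair_eq (p ⊗ₘ 𝟙 _) (𝟙 _ ⊗ₘ q) h1 h2)
    (by
      rintro _ _ x ⟨p, q, l, r⟩
      have h1 := pcomp_nat l x.l p q (𝟙 _) (𝟙 _)
      have h2 := pcomp_nat x.r r (𝟙 _) (𝟙 _) q p
      simp only [id_whiskerRight, Category.id_comp, Category.comp_id] at h1 h2
      exact ofPair_eq (𝟙 _ ⊗ₘ p) (q ⊗ₘ 𝟙 _) h1 h2)

/-- The learner `(I ⊗ f | I ⊗ g)` given by a pair of maps of `C`. -/
def Hom.pure {X Y : Learn C} (f : X.fst ⟶ Y.fst) (g : Y.snd ⟶ X.snd) : Hom X Y :=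
  ofPair (𝟙_ C ◁ f) (𝟙_ C ◁ g)

theorem pure_comp {X Y Z : Learn C} (f : X.fst ⟶ Y.fst) (g : Y.snd ⟶ X.snd) {P Q : C}
    (l : P ⊗ Y.fst ⟶ Q ⊗ Z.fst) (r : Q ⊗ Z.snd ⟶ P ⊗ Y.snd) :
    (Hom.pure f g).comp (ofPair l r) = ofPair (P ◁ f ≫ l) (r ≫ P ◁ g) :=
  ofPair_eq (ρ_ P).hom (λ_ Q).inv (pcomp_pure_left f l) (by
    change _ = _ ≫ pcomp r (𝟙_ C ◁ g) ≫ _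
    rw [pcomp_pure_right]
    simp [← comp_whiskerRight])

theorem comp_pure {X Y Z : Learn C} (f : Y.fst ⟶ Z.fst) (g : Z.snd ⟶ Y.snd) {P Q : C}
    (l : P ⊗ X.fst ⟶ Q ⊗ Y.fst) (r : Q ⊗ Y.snd ⟶ P ⊗ X.snd) :
    (ofPair l r).comp (Hom.pure f g) = ofPair (l ≫ Q ◁ f) (Q ◁ g ≫ r) :=
  ofPair_eq (λ_ P).hom (ρ_ Q).inv (pcomp_pure_right l f) (by
    change _ = _ ≫ pcomp (𝟙_ C ◁ g) r ≫ _
    rw [pcomp_pure_left]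
    simp [← comp_whiskerRight_assoc])

/-- The category of learners; the identity is `(𝟙 (I ⊗ A) | 𝟙 (I ⊗ A'))`. -/
instance : Category.{max u v} (Learn C) where
  Hom := Hom
  id X := ofPair (𝟙 (𝟙_ C ⊗ X.fst)) (𝟙 (𝟙_ C ⊗ X.snd))
  comp := Hom.comp
  id_comp {X Y} f := by
    induction f using ind with
    | h P Q l r => simpa [Hom.pure] using pure_comp (𝟙 X.fst) (𝟙 X.snd) l r
  comp_id {X Y} f := by
    induction f using ind with
    | h P Q l r => simpa [Hom.pure] using comp_pure (𝟙 Y.fst) (𝟙 Y.snd) l r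
  assoc f g h := by
    induction f using ind with
    | h P₁ Q₁ l₁ r₁ =>
    induction g using ind with
    | h P₂ Q₂ l₂ r₂ =>
    induction h using ind with
    | h P₃ Q₃ l₃ r₃ =>
      exact (ofPair_eq (α_ P₃ P₂ P₁).hom (α_ Q₁ Q₂ Q₃).hom (pcomp_assoc l₁ l₂ l₃)
        (pcomp_assoc r₃ r₂ r₁)).symm

/-- `Hom.pure` as a morphism of the category of learners. -/
def ofHom {X Y : Learn C} (f : X.fst ⟶ Y.fst) (g : Y.snd ⟶ X.snd) : X ⟶ Y := Hom.pure f g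

theorem ofHom_comp_ofPair {X Y Z : Learn C} (f : X.fst ⟶ Y.fst) (g : Y.snd ⟶ X.snd) {P Q : C}
    (l : P ⊗ Y.fst ⟶ Q ⊗ Z.fst) (r : Q ⊗ Z.snd ⟶ P ⊗ Y.snd) :
    (ofHom f g ≫ ofPair l r : X ⟶ Z) = ofPair (P ◁ f ≫ l) (r ≫ P ◁ g) := pure_comp f g l r

theorem ofPair_comp_ofHom {X Y Z : Learn C} (f : Y.fst ⟶ Z.fst) (g : Z.snd ⟶ Y.snd) {P Q : C}
    (l : P ⊗ X.fst ⟶ Q ⊗ Y.fst) (r : Q ⊗ Y.snd ⟶ P ⊗ X.snd) :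
    ((ofPair l r : X ⟶ Y) ≫ ofHom f g : X ⟶ Z) = ofPair (l ≫ Q ◁ f) (Q ◁ g ≫ r) := comp_pure f g l r

theorem ofPair_comp_ofPair {X Y Z : Learn C} {P₁ Q₁ P₂ Q₂ : C}
    (l₁ : P₁ ⊗ X.fst ⟶ Q₁ ⊗ Y.fst) (r₁ : Q₁ ⊗ Y.snd ⟶ P₁ ⊗ X.snd)
    (l₂ : P₂ ⊗ Y.fst ⟶ Q₂ ⊗ Z.fst) (r₂ : Q₂ ⊗ Z.snd ⟶ P₂ ⊗ Y.snd) :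
    ((ofPair l₁ r₁ : X ⟶ Y) ≫ (ofPair l₂ r₂ : Y ⟶ Z) : X ⟶ Z) = ofPair (pcomp l₁ l₂) (pcomp r₂ r₁) := rfl

theorem ofHom_id (X : Learn C) : ofHom (𝟙 X.fst) (𝟙 X.snd) = 𝟙 X := by
  change ofPair _ _ = ofPair _ _
  simp

theorem ofHom_comp {X Y Z : Learn C} (f : X.fst ⟶ Y.fst) (g : Y.snd ⟶ X.snd)
    (f' : Y.fst ⟶ Z.fst) (g' : Z.snd ⟶ Y.snd) :
    ofHom f g ≫ ofHom f' g' = ofHom (f ≫ f') (g' ≫ g) := by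
  refine (ofHom_comp_ofPair f g (𝟙_ C ◁ f') (𝟙_ C ◁ g')).trans ?_
  simp [ofHom, Hom.pure]

/-- A pair of isomorphisms of `C` gives an isomorphism of learners. -/
def ofIso {X Y : Learn C} (f : X.fst ≅ Y.fst) (g : Y.snd ≅ X.snd) : X ≅ Y where
  hom := ofHom f.hom g.hom
  inv := ofHom f.inv g.inv
  hom_inv_id := by simp [ofHom_comp, ofHom_id]
  inv_hom_id := by simp [ofHom_comp, ofHom_id]

/-- `(A, A') ⊗ (B, B') = (A ⊗ B, B' ⊗ A')`. -/
def tensor (X Y : Learn C) : Learn C := ⟨X.fst ⊗ Y.fst, Y.snd ⊗ X.snd⟩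

/-- The learner `(l | r)` next to the identity of `W`, on the right of `W`. -/
def Hom.whiskerL (W : Learn C) {X Y : Learn C} :
    Hom X Y → Hom (tensor W X) (tensor W Y) :=
  Quot.lift (fun x => ofPair (X := tensor W X) (Y := tensor W Y) (wl W.fst x.l) (wr x.r W.snd))
    (by
      rintro _ _ ⟨p, q, l, r⟩
      exact ofPair_eq (X := tensor W X) (Y := tensor W Y) p q (wl_nat _ _ _ _) (wr_nat _ _ _ _))

/-- The learner `(l | r)` next to the identity of `W`, on the left of `W`. -/
def Hom.whiskerR {X Y : Learn C} (f : Hom X Y) (W : Learn C) :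
    Hom (tensor X W) (tensor Y W) :=
  Quot.lift (fun x => ofPair (X := tensor X W) (Y := tensor Y W) (wr x.l W.fst) (wl W.snd x.r))
    (by
      rintro _ _ ⟨p, q, l, r⟩
      exact ofPair_eq (X := tensor X W) (Y := tensor Y W) p q (wr_nat _ _ _ _) (wl_nat _ _ _ _)) f

/-- The tensor product `(A, A') ⊗ (B, B') = (A ⊗ B, B' ⊗ A')` of learners. On morphisms the tensor
product is `f ⊗ₘ g = f ▷ _ ≫ _ ◁ g`, i.e. the two learners are placed side by side, with all
parameter wires moved to the left. -/
instance : MonoidalCategoryStruct (Learn C) where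
  tensorObj := tensor
  tensorUnit := ⟨𝟙_ C, 𝟙_ C⟩
  whiskerLeft W _ _ f := Hom.whiskerL W f
  whiskerRight f W := Hom.whiskerR f W
  associator X Y Z := ofIso (X := tensor (tensor X Y) Z) (Y := tensor X (tensor Y Z))
    (α_ X.fst Y.fst Z.fst) (α_ Z.snd Y.snd X.snd)
  leftUnitor X := ofIso (X := tensor ⟨𝟙_ C, 𝟙_ C⟩ X) (Y := X) (λ_ X.fst) (ρ_ X.snd).symm
  rightUnitor X := ofIso (X := tensor X ⟨𝟙_ C, 𝟙_ C⟩) (Y := X) (ρ_ X.fst) (λ_ X.snd).symm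

theorem whiskerLeft_ofPair (W : Learn C) {X Y : Learn C} {P Q : C}
    (l : P ⊗ X.fst ⟶ Q ⊗ Y.fst) (r : Q ⊗ Y.snd ⟶ P ⊗ X.snd) :
    W ◁ (ofPair l r : X ⟶ Y) =
      (ofPair (X := W ⊗ X) (Y := W ⊗ Y) (wl W.fst l) (wr r W.snd) : W ⊗ X ⟶ W ⊗ Y) := rfl

theorem ofPair_whiskerRight {X Y : Learn C} {P Q : C}
    (l : P ⊗ X.fst ⟶ Q ⊗ Y.fst) (r : Q ⊗ Y.snd ⟶ P ⊗ X.snd) (W : Learn C) :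
    (ofPair l r : X ⟶ Y) ▷ W =
      (ofPair (X := X ⊗ W) (Y := Y ⊗ W) (wr l W.fst) (wl W.snd r) : X ⊗ W ⟶ Y ⊗ W) := rfl

theorem whiskerLeft_ofHom (W : Learn C) {X Y : Learn C} (f : X.fst ⟶ Y.fst)
    (g : Y.snd ⟶ X.snd) :
    W ◁ ofHom f g = ofHom (X := W ⊗ X) (Y := W ⊗ Y) (W.fst ◁ f) (g ▷ W.snd) := by
  change ofPair (X := W ⊗ X) (Y := W ⊗ Y) (wl W.fst (𝟙_ C ◁ f)) (wr (𝟙_ C ◁ g) W.snd) = _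
  rw [wl_pure, wr_pure]
  rfl

theorem ofHom_whiskerRight {X Y : Learn C} (f : X.fst ⟶ Y.fst) (g : Y.snd ⟶ X.snd)
    (W : Learn C) :
    ofHom f g ▷ W = ofHom (X := X ⊗ W) (Y := Y ⊗ W) (f ▷ W.fst) (W.snd ◁ g) := by
  change ofPair (X := X ⊗ W) (Y := Y ⊗ W) (wr (𝟙_ C ◁ f) W.fst) (wl W.snd (𝟙_ C ◁ g)) = _
  rw [wl_pure, wr_pure]
  rfl

theorem whiskerLeft_id' (W X : Learn C) : W ◁ 𝟙 X = 𝟙 (W ⊗ X) := by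
  rw [← ofHom_id, whiskerLeft_ofHom, ← ofHom_id]
  simp [MonoidalCategoryStruct.tensorObj, tensor]

theorem id_whiskerRight' (X W : Learn C) : 𝟙 X ▷ W = 𝟙 (X ⊗ W) := by
  rw [← ofHom_id, ofHom_whiskerRight, ← ofHom_id]
  simp [MonoidalCategoryStruct.tensorObj, tensor]

theorem whiskerLeft_comp' (W : Learn C) {X Y Z : Learn C} (f : X ⟶ Y) (g : Y ⟶ Z) :
    W ◁ (f ≫ g) = W ◁ f ≫ W ◁ g := by
  induction f using ind with
  | h P₁ Q₁ l₁ r₁ =>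
  induction g using ind with
  | h P₂ Q₂ l₂ r₂ =>
    rw [ofPair_comp_ofPair, whiskerLeft_ofPair, wl_pcomp, wr_pcomp]
    rfl

theorem comp_whiskerRight' {X Y Z : Learn C} (f : X ⟶ Y) (g : Y ⟶ Z) (W : Learn C) :
    (f ≫ g) ▷ W = f ▷ W ≫ g ▷ W := by
  induction f using ind with
  | h P₁ Q₁ l₁ r₁ =>
  induction g using ind with
  | h P₂ Q₂ l₂ r₂ =>
    rw [ofPair_comp_ofPair, ofPair_whiskerRight, wl_pcomp, wr_pcomp]
    rfl

theorem whisker_exchange' {W X Y Z : Learn C} (f : W ⟶ X) (g : Y ⟶ Z) :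
    W ◁ g ≫ f ▷ Z = f ▷ Y ≫ X ◁ g := by
  induction f using ind with
  | h P Q l r =>
  induction g using ind with
  | h R S l' r' =>
    refine (ofPair_eq (X := W ⊗ Y) (Y := X ⊗ Z) (β_ R P).hom (β_ S Q).hom
      (pcomp_exchange l l').symm ?_).symm
    change pcomp (wl Z.snd r) (wr r' W.snd) =
      (β_ S Q).hom ▷ (Z.snd ⊗ X.snd) ≫ pcomp (wr r' X.snd) (wl Y.snd r) ≫
        (β_ R P).hom ▷ (Y.snd ⊗ W.snd)
    rw [← pcomp_exchange r' r]
    simp only [Category.assoc, ← comp_whiskerRight, ← comp_whiskerRight_assoc,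
      SymmetricCategory.symmetry, id_whiskerRight, Category.comp_id, Category.id_comp]

theorem ofPair_congr {X Y : Learn C} {P Q : C} {l l' : P ⊗ X.fst ⟶ Q ⊗ Y.fst}
    {r r' : Q ⊗ Y.snd ⟶ P ⊗ X.snd} (hl : l = l') (hr : r = r') :
    ofPair l r = ofPair l' r' := by
  rw [hl, hr]

theorem nat_of_ofPair {X X' Y Y' : Learn C} {P Q : C}
    (l : P ⊗ X.fst ⟶ Q ⊗ Y.fst) (r : Q ⊗ Y.snd ⟶ P ⊗ X.snd)
    (l' : P ⊗ X'.fst ⟶ Q ⊗ Y'.fst) (r' : Q ⊗ Y'.snd ⟶ P ⊗ X'.snd)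
    (f : X.fst ⟶ X'.fst) (g : X'.snd ⟶ X.snd) (f' : Y.fst ⟶ Y'.fst) (g' : Y'.snd ⟶ Y.snd)
    (hl : l ≫ Q ◁ f' = P ◁ f ≫ l') (hr : Q ◁ g' ≫ r = r' ≫ P ◁ g) :
    (ofPair l r : X ⟶ Y) ≫ ofHom f' g' = ofHom f g ≫ (ofPair l' r' : X' ⟶ Y') := by
  rw [ofPair_comp_ofHom, ofHom_comp_ofPair]
  exact ofPair_congr hl hr

theorem associator_nat_right (X Y : Learn C) {Z Z' : Learn C} (f : Z ⟶ Z') :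
    (X ⊗ Y) ◁ f ≫ (α_ X Y Z').hom = (α_ X Y Z).hom ≫ X ◁ Y ◁ f := by
  induction f using ind with
  | h P Q l r =>
    exact nat_of_ofPair (X := (X ⊗ Y) ⊗ Z) (Y := (X ⊗ Y) ⊗ Z') (X' := X ⊗ (Y ⊗ Z))
      (Y' := X ⊗ (Y ⊗ Z')) _ _ _ _ _ _ _ _ (wl_tensor _ _ l) (wr_tensor r _ _)

theorem associator_nat_mid (X : Learn C) {Y Y' : Learn C} (f : Y ⟶ Y') (Z : Learn C) :
    (X ◁ f) ▷ Z ≫ (α_ X Y' Z).hom = (α_ X Y Z).hom ≫ X ◁ (f ▷ Z) := by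
  induction f using ind with
  | h P Q l r =>
    exact nat_of_ofPair (X := (X ⊗ Y) ⊗ Z) (Y := (X ⊗ Y') ⊗ Z) (X' := X ⊗ (Y ⊗ Z))
      (Y' := X ⊗ (Y' ⊗ Z)) _ _ _ _ _ _ _ _ (wr_wl _ l _) (wr_wl _ r _).symm

theorem associator_nat_left {X X' : Learn C} (f : X ⟶ X') (Y Z : Learn C) :
    f ▷ Y ▷ Z ≫ (α_ X' Y Z).hom = (α_ X Y Z).hom ≫ f ▷ (Y ⊗ Z) := by
  induction f using ind with
  | h P Q l r =>
    exact nat_of_ofPair (X := (X ⊗ Y) ⊗ Z) (Y := (X' ⊗ Y) ⊗ Z) (X' := X ⊗ (Y ⊗ Z))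
      (Y' := X' ⊗ (Y ⊗ Z)) _ _ _ _ _ _ _ _ (wr_tensor l _ _).symm (wl_tensor _ _ r).symm

theorem leftUnitor_nat {X Y : Learn C} (f : X ⟶ Y) :
    𝟙_ (Learn C) ◁ f ≫ (λ_ Y).hom = (λ_ X).hom ≫ f := by
  induction f using ind with
  | h P Q l r =>
    refine nat_of_ofPair (X := 𝟙_ (Learn C) ⊗ X) (Y := 𝟙_ (Learn C) ⊗ Y) (X' := X) (Y' := Y)
      _ _ _ _ _ _ _ _ (wl_unit l) ?_
    change Q ◁ (ρ_ Y.snd).inv ≫ wr r (𝟙_ C) = r ≫ P ◁ (ρ_ X.snd).inv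
    rw [← cancel_mono (P ◁ (ρ_ X.snd).hom), Category.assoc, wr_unit]
    simp

theorem rightUnitor_nat {X Y : Learn C} (f : X ⟶ Y) :
    f ▷ 𝟙_ (Learn C) ≫ (ρ_ Y).hom = (ρ_ X).hom ≫ f := by
  induction f using ind with
  | h P Q l r =>
    refine nat_of_ofPair (X := X ⊗ 𝟙_ (Learn C)) (Y := Y ⊗ 𝟙_ (Learn C)) (X' := X) (Y' := Y)
      _ _ _ _ _ _ _ _ (wr_unit l) ?_
    change Q ◁ (λ_ Y.snd).inv ≫ wl (𝟙_ C) r = r ≫ P ◁ (λ_ X.snd).inv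
    rw [← cancel_mono (P ◁ (λ_ X.snd).hom), Category.assoc, wl_unit]
    simp

theorem ofHom_congr {X Y : Learn C} {f f' : X.fst ⟶ Y.fst} {g g' : Y.snd ⟶ X.snd}
    (hf : f = f') (hg : g = g') : ofHom f g = ofHom f' g' := by
  rw [hf, hg]

theorem associator_hom (X Y Z : Learn C) :
    (α_ X Y Z).hom = ofHom (X := (X ⊗ Y) ⊗ Z) (Y := X ⊗ (Y ⊗ Z)) (α_ X.fst Y.fst Z.fst).hom
      (α_ Z.snd Y.snd X.snd).hom := rfl

theorem leftUnitor_hom (X : Learn C) :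
    (λ_ X).hom = ofHom (X := 𝟙_ (Learn C) ⊗ X) (Y := X) (λ_ X.fst).hom (ρ_ X.snd).inv := rfl

theorem rightUnitor_hom (X : Learn C) :
    (ρ_ X).hom = ofHom (X := X ⊗ 𝟙_ (Learn C)) (Y := X) (ρ_ X.fst).hom (λ_ X.snd).inv := rfl

theorem comp_eq_ofHom {X Y Z : Learn C} {F : X ⟶ Y} {G : Y ⟶ Z} {f : X.fst ⟶ Y.fst}
    {g : Y.snd ⟶ X.snd} {f' : Y.fst ⟶ Z.fst} {g' : Z.snd ⟶ Y.snd}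
    (hF : F = ofHom f g) (hG : G = ofHom f' g') : F ≫ G = ofHom (f ≫ f') (g' ≫ g) := by
  rw [hF, hG, ofHom_comp]

theorem whiskerLeft_eq_ofHom (W : Learn C) {X Y : Learn C} {F : X ⟶ Y} {f : X.fst ⟶ Y.fst}
    {g : Y.snd ⟶ X.snd} (hF : F = ofHom f g) :
    W ◁ F = ofHom (X := W ⊗ X) (Y := W ⊗ Y) (W.fst ◁ f) (g ▷ W.snd) := by
  rw [hF, whiskerLeft_ofHom]

theorem whiskerRight_eq_ofHom {X Y : Learn C} {F : X ⟶ Y} {f : X.fst ⟶ Y.fst}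
    {g : Y.snd ⟶ X.snd} (hF : F = ofHom f g) (W : Learn C) :
    F ▷ W = ofHom (X := X ⊗ W) (Y := Y ⊗ W) (f ▷ W.fst) (W.snd ◁ g) := by
  rw [hF, ofHom_whiskerRight]

instance : MonoidalCategory (Learn C) where
  tensorHom_def _ _ := rfl
  id_tensorHom_id X Y := by
    change 𝟙 X ▷ Y ≫ X ◁ 𝟙 Y = _
    rw [whiskerLeft_id', id_whiskerRight', Category.comp_id]
  tensorHom_comp_tensorHom {X₁ Y₁ Z₁ X₂ Y₂ Z₂} f₁ f₂ g₁ g₂ := by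
    change (f₁ ▷ _ ≫ _ ◁ f₂) ≫ (g₁ ▷ _ ≫ _ ◁ g₂) = (f₁ ≫ g₁) ▷ _ ≫ _ ◁ (f₂ ≫ g₂)
    rw [comp_whiskerRight', whiskerLeft_comp', Category.assoc, Category.assoc,
      reassoc_of% (whisker_exchange' g₁ f₂)]
  whiskerLeft_id := whiskerLeft_id'
  id_whiskerRight := id_whiskerRight'
  associator_naturality {X₁ X₂ X₃ Y₁ Y₂ Y₃} f₁ f₂ f₃ := by
    change ((f₁ ▷ X₂ ≫ Y₁ ◁ f₂) ▷ X₃ ≫ (Y₁ ⊗ Y₂) ◁ f₃) ≫ _ =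
      _ ≫ f₁ ▷ (X₂ ⊗ X₃) ≫ Y₁ ◁ (f₂ ▷ X₃ ≫ Y₂ ◁ f₃)
    rw [comp_whiskerRight', whiskerLeft_comp', Category.assoc, Category.assoc,
      associator_nat_right, reassoc_of% (associator_nat_mid Y₁ f₂ X₃),
      reassoc_of% (associator_nat_left f₁ X₂ X₃)]
  leftUnitor_naturality := leftUnitor_nat
  rightUnitor_naturality := rightUnitor_nat
  pentagon W X Y Z :=
    (comp_eq_ofHom (whiskerRight_eq_ofHom (associator_hom W X Y) Z) (comp_eq_ofHom
      (associator_hom W (X ⊗ Y) Z) (whiskerLeft_eq_ofHom W (associator_hom X Y Z)))).trans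
    ((ofHom_congr (pentagon _ _ _ _)
      ((Category.assoc _ _ _).trans (pentagon Z.snd Y.snd X.snd W.snd))).trans
    (comp_eq_ofHom (associator_hom (W ⊗ X) Y Z) (associator_hom W X (Y ⊗ Z))).symm)
  triangle X Y :=
    (comp_eq_ofHom (associator_hom X (𝟙_ _) Y)
      (whiskerLeft_eq_ofHom X (leftUnitor_hom Y))).trans
    ((ofHom_congr (triangle _ _) (triangle_assoc_comp_right_inv Y.snd X.snd)).trans
    (whiskerRight_eq_ofHom (rightUnitor_hom X) Y).symm)

theorem associator_inv (X Y Z : Learn C) :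
    (α_ X Y Z).inv = ofHom (X := X ⊗ (Y ⊗ Z)) (Y := (X ⊗ Y) ⊗ Z) (α_ X.fst Y.fst Z.fst).inv
      (α_ Z.snd Y.snd X.snd).inv := rfl

/-- The symmetry of learners, as a learner. -/
def braid (X Y : Learn C) : X ⊗ Y ≅ Y ⊗ X :=
  ofIso (X := X ⊗ Y) (Y := Y ⊗ X) (β_ X.fst Y.fst) (β_ X.snd Y.snd)

theorem braid_hom (X Y : Learn C) :
    (braid X Y).hom = ofHom (X := X ⊗ Y) (Y := Y ⊗ X) (β_ X.fst Y.fst).hom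
      (β_ X.snd Y.snd).hom := rfl

/-- The symmetry of learners is induced by the symmetry of `C`. -/
instance : SymmetricCategory (Learn C) where
  braiding := braid
  braiding_naturality_right X {Y Z} f := by
    induction f using ind with
    | h P Q l r =>
      refine nat_of_ofPair (X := X ⊗ Y) (Y := X ⊗ Z) (X' := Y ⊗ X) (Y' := Z ⊗ X)
        _ _ _ _ _ _ _ _ (wl_braid _ l) (wl_braid _ r).symm
  braiding_naturality_left {X Y} f Z := by
    induction f using ind with
    | h P Q l r =>
      refine nat_of_ofPair (X := X ⊗ Z) (Y := Y ⊗ Z) (X' := Z ⊗ X) (Y' := Z ⊗ Y)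
        _ _ _ _ _ _ _ _ (wr_braid l _) (wr_braid r _).symm
  hexagon_forward X Y Z :=
    (comp_eq_ofHom (associator_hom X Y Z) (comp_eq_ofHom (braid_hom X (Y ⊗ Z))
      (associator_hom Y Z X))).trans
    ((ofHom_congr (hexagon_forward _ _ _) (hexagon_snd_forward X.snd Y.snd Z.snd)).trans
    (comp_eq_ofHom (whiskerRight_eq_ofHom (braid_hom X Y) Z) (comp_eq_ofHom (associator_hom Y X Z)
      (whiskerLeft_eq_ofHom Y (braid_hom X Z)))).symm)
  hexagon_reverse X Y Z :=
    (comp_eq_ofHom (associator_inv X Y Z) (comp_eq_ofHom (braid_hom (X ⊗ Y) Z)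
      (associator_inv Z X Y))).trans
    ((ofHom_congr (hexagon_reverse _ _ _) (hexagon_snd_reverse X.snd Y.snd Z.snd)).trans
    (comp_eq_ofHom (whiskerLeft_eq_ofHom X (braid_hom Y Z)) (comp_eq_ofHom (associator_inv X Z Y)
      (whiskerRight_eq_ofHom (braid_hom X Z) Y))).symm)
  symmetry X Y := by
    refine (ofHom_comp _ _ _ _).trans (Eq.trans (ofHom_congr ?_ ?_) (ofHom_id _))
    · exact SymmetricCategory.symmetry _ _
    · exact SymmetricCategory.symmetry _ _

/-- The cup `η : (I, I) ⟶ (A, A') ⊗ (A, A')^*`, with `P = A ⊗ A'` and `Q = I`. -/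
def cup (X : Learn C) : 𝟙_ (Learn C) ⟶ X ⊗ X.dual :=
  ofPair (X := 𝟙_ (Learn C)) (Y := X ⊗ X.dual) (P := X.fst ⊗ X.snd) (Q := 𝟙_ C)
    ((ρ_ (X.fst ⊗ X.snd)).hom ≫ (λ_ (X.fst ⊗ X.snd)).inv)
    ((λ_ (X.fst ⊗ X.snd)).hom ≫ (ρ_ (X.fst ⊗ X.snd)).inv)

/-- The cap `ε : (A, A')^* ⊗ (A, A') ⟶ (I, I)`, with `P = I` and `Q = A' ⊗ A`. -/
def cap (X : Learn C) : X.dual ⊗ X ⟶ 𝟙_ (Learn C) :=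
  ofPair (X := X.dual ⊗ X) (Y := 𝟙_ (Learn C)) (P := 𝟙_ C) (Q := X.snd ⊗ X.fst)
    ((λ_ (X.snd ⊗ X.fst)).hom ≫ (ρ_ (X.snd ⊗ X.fst)).inv)
    ((ρ_ (X.snd ⊗ X.fst)).hom ≫ (λ_ (X.snd ⊗ X.fst)).inv)

/-- The involution `(l | r)^* = (r | l)` on morphisms of the category of learners. -/
def star {X Y : Learn C} (f : X ⟶ Y) : Y.dual ⟶ X.dual := Hom.dual f

/-- The snake diagram `X ⟶ (X ⊗ X^*) ⊗ X ⟶ X ⊗ (X^* ⊗ X) ⟶ X`. -/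
def snake (X : Learn C) : X ⟶ X :=
  (λ_ X).inv ≫ cup X ▷ X ≫ (α_ X X.dual X).hom ≫ X ◁ cap X ≫ (ρ_ X).hom

/-- The smallest monoidal congruence (an equivalence relation on parallel morphisms compatible with
composition and tensor product) that identifies every snake diagram with an identity. -/
inductive SnakeRel : HomRel (Learn C)
  | snake (X : Learn C) : SnakeRel (snake X) (𝟙 X)
  | refl {X Y : Learn C} (f : X ⟶ Y) : SnakeRel f f
  | symm {X Y : Learn C} {f g : X ⟶ Y} : SnakeRel f g → SnakeRel g f
  | trans {X Y : Learn C} {f g h : X ⟶ Y} : SnakeRel f g → SnakeRel g h → SnakeRel f h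
  | comp {X Y Z : Learn C} {f f' : X ⟶ Y} {g g' : Y ⟶ Z} :
      SnakeRel f f' → SnakeRel g g' → SnakeRel (f ≫ g) (f' ≫ g')
  | tensor {X Y Z W : Learn C} {f f' : X ⟶ Y} {g g' : Z ⟶ W} :
      SnakeRel f f' → SnakeRel g g' → SnakeRel (f ⊗ₘ g) (f' ⊗ₘ g')

end Learn

/-! ### The category of atemporal learners -/

/-- The category of atemporal learners on `C`: the quotient of the symmetric monoidal category of
learners by `Learn.SnakeRel`. -/
def Atemp (C : Type u) [Category.{v} C] [MonoidalCategory C] [SymmetricCategory C] : Type u :=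
  CategoryTheory.Quotient (Learn.SnakeRel (C := C))

namespace Atemp

variable {C : Type u} [Category.{v} C] [MonoidalCategory C] [SymmetricCategory C]

instance : Category.{max u v} (Atemp C) :=
  inferInstanceAs (Category (CategoryTheory.Quotient (Learn.SnakeRel (C := C))))

variable (C) in
/-- The quotient functor. -/
def proj : Learn C ⥤ Atemp C := CategoryTheory.Quotient.functor _

/-- The atemporal object `(A, A')`. -/
def of (X : Learn C) : Atemp C := (proj C).obj X

theorem proj_sound {X Y : Learn C} {f g : X ⟶ Y} (h : Learn.SnakeRel f g) :
    (proj C).map f = (proj C).map g := CategoryTheory.Quotient.sound _ h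

theorem proj_surj {X Y : Atemp C} (f : X ⟶ Y) :
    ∃ g : X.as ⟶ Y.as, (proj C).map g = f :=
  (CategoryTheory.Quotient.full_functor _).map_surjective f

/-- The tensor product on the left with `W` descends to the quotient. -/
def whiskerL (W : Learn C) : Atemp C ⥤ Atemp C :=
  CategoryTheory.Quotient.lift _ (tensorLeft W ⋙ proj C) (fun _ _ f g h => proj_sound (by
    simpa using Learn.SnakeRel.tensor (Learn.SnakeRel.refl (𝟙 W)) h))

/-- The tensor product on the right with `W` descends to the quotient. -/
def whiskerR (W : Learn C) : Atemp C ⥤ Atemp C :=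
  CategoryTheory.Quotient.lift _ (tensorRight W ⋙ proj C) (fun _ _ f g h => proj_sound (by
    simpa using Learn.SnakeRel.tensor h (Learn.SnakeRel.refl (𝟙 W))))

instance : MonoidalCategoryStruct (Atemp C) where
  tensorObj X Y := of (X.as ⊗ Y.as)
  tensorUnit := of (𝟙_ (Learn C))
  whiskerLeft W _ _ f := (whiskerL W.as).map f
  whiskerRight f W := (whiskerR W.as).map f
  associator X Y Z := (proj C).mapIso (α_ X.as Y.as Z.as)
  leftUnitor X := (proj C).mapIso (λ_ X.as)
  rightUnitor X := (proj C).mapIso (ρ_ X.as)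

theorem proj_whiskerLeft (W : Learn C) {X Y : Learn C} (f : X ⟶ Y) :
    (proj C).map (W ◁ f) = of W ◁ (proj C).map f := rfl

theorem proj_whiskerRight {X Y : Learn C} (f : X ⟶ Y) (W : Learn C) :
    (proj C).map (f ▷ W) = (proj C).map f ▷ of W := rfl

theorem proj_tensor {X Y Z W : Learn C} (f : X ⟶ Y) (g : Z ⟶ W) :
    (proj C).map (f ⊗ₘ g) = (proj C).map f ⊗ₘ (proj C).map g := by
  rw [MonoidalCategory.tensorHom_def, Functor.map_comp]
  rfl

instance : MonoidalCategory (Atemp C) where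
  tensorHom_def _ _ := rfl
  id_tensorHom_id X Y :=
    (proj_tensor (𝟙 X.as) (𝟙 Y.as)).symm.trans
      (congrArg (proj C).map (id_tensorHom_id X.as Y.as))
  tensorHom_comp_tensorHom f₁ f₂ g₁ g₂ := by
    obtain ⟨f₁, rfl⟩ := proj_surj f₁
    obtain ⟨f₂, rfl⟩ := proj_surj f₂
    obtain ⟨g₁, rfl⟩ := proj_surj g₁
    obtain ⟨g₂, rfl⟩ := proj_surj g₂
    exact (congrArg₂ _ (proj_tensor f₁ f₂) (proj_tensor g₁ g₂)).symm.trans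
      ((congrArg (proj C).map (tensorHom_comp_tensorHom f₁ f₂ g₁ g₂)).trans
      (proj_tensor (f₁ ≫ g₁) (f₂ ≫ g₂)))
  whiskerLeft_id X Y := congrArg (proj C).map (whiskerLeft_id X.as Y.as)
  id_whiskerRight X Y := congrArg (proj C).map (id_whiskerRight X.as Y.as)
  associator_naturality f₁ f₂ f₃ := by
    obtain ⟨f₁, rfl⟩ := proj_surj f₁
    obtain ⟨f₂, rfl⟩ := proj_surj f₂
    obtain ⟨f₃, rfl⟩ := proj_surj f₃
    exact congrArg (proj C).map (associator_naturality f₁ f₂ f₃)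
  leftUnitor_naturality f := by
    obtain ⟨f, rfl⟩ := proj_surj f
    exact congrArg (proj C).map (leftUnitor_naturality f)
  rightUnitor_naturality f := by
    obtain ⟨f, rfl⟩ := proj_surj f
    exact congrArg (proj C).map (rightUnitor_naturality f)
  pentagon W X Y Z := congrArg (proj C).map (pentagon W.as X.as Y.as Z.as)
  triangle X Y := congrArg (proj C).map (triangle X.as Y.as)

instance : SymmetricCategory (Atemp C) where
  braiding X Y := (proj C).mapIso (β_ X.as Y.as)
  braiding_naturality_right X _ _ f := by
    obtain ⟨f, rfl⟩ := proj_surj f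
    exact congrArg (proj C).map (braiding_naturality_right X.as f)
  braiding_naturality_left f Z := by
    obtain ⟨f, rfl⟩ := proj_surj f
    exact congrArg (proj C).map (braiding_naturality_left f Z.as)
  hexagon_forward X Y Z := congrArg (proj C).map (hexagon_forward X.as Y.as Z.as)
  hexagon_reverse X Y Z := congrArg (proj C).map (hexagon_reverse X.as Y.as Z.as)
  symmetry X Y := congrArg (proj C).map (SymmetricCategory.symmetry X.as Y.as)

/-- The image of the cup `η` in the quotient. -/
def cup (X : Learn C) : 𝟙_ (Atemp C) ⟶ of X ⊗ of X.dual := (proj C).map (Learn.cup X)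

/-- The image of the cap `ε` in the quotient. -/
def cap (X : Learn C) : of X.dual ⊗ of X ⟶ 𝟙_ (Atemp C) := (proj C).map (Learn.cap X)

end Atemp

/-! The parameter wires of a learner can be read as stored values, and the coend lets a map that
touches parameters only be slid from one component to the other. Read this way, the snake on `(A,
A')` is a pair of delays: the left component outputs the stored `A` and keeps the incoming one, and
the right component does the same with `A'` (`snake_eq`). For `A' = I` only the delay of `A`
survives. As `(A, A') ≅ (A, I) ⊗ (I, A')`, the congruence therefore makes every `fstDelay` trivial
(`snakeRel_fstDelay`). The involution carries the snake of `X` to the snake of `X.dual`, so it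
preserves the congruence (`SnakeRel.star`), and every `sndDelay` is trivial as well. For `f = (l |
r)`, the two sides of extranaturality of the cup are essentially `(l | r)` and `(r | l)`. The
obstacle to sliding `r` is that it consumes the external input `B'`. With a delay of `B'` inserted,
`r` acts on stored wires alone and can be slid to the left; the left component starts at `I`, so `l`
acts on parameters there and can be slid to the right. With delays the two sides are thus already
equal before the quotient (`cup_extranatural_delay`), and the delays then disappear. The involution
gives the statement for the cap. The second snake equation is the mirror image, under the symmetry,
of the first one for `X.dual` (`snake_braided`, `cup_braid`, `braid_cap`). -/

namespace Learner
variable {C : Type u} [Category.{v} C] [MonoidalCategory C] [SymmetricCategory C]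

/-- Reflecting a snake: the crossings hidden in `η'` and `ε'` can be traded for moving the free
strand `X` across all of `η` and all of `ε`, and naturality of the braiding then leaves the original
snake. -/
theorem snake_braided {X Y : C} {η : 𝟙_ C ⟶ X ⊗ Y} {ε : Y ⊗ X ⟶ 𝟙_ C} {η' : 𝟙_ C ⟶ Y ⊗ X}
    {ε' : X ⊗ Y ⟶ 𝟙_ C} (h : η ▷ X ≫ (α_ X Y X).hom ≫ X ◁ ε = (λ_ X).hom ≫ (ρ_ X).inv)
    (hη : η ≫ (β_ X Y).hom = η') (hε : (β_ X Y).hom ≫ ε = ε') :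
    X ◁ η' ≫ (α_ X Y X).inv ≫ ε' ▷ X = (ρ_ X).hom ≫ (λ_ X).inv := by
  subst hη hε
  have key : X ◁ (β_ X Y).hom ≫ (α_ X Y X).inv ≫ (β_ X Y).hom ▷ X =
      (β_ X (X ⊗ Y)).hom ≫ (α_ X Y X).hom ≫ (β_ X (Y ⊗ X)).hom := by
    -- The crossings added on both sides of Yang–Baxter cancel by symmetry against the unwanted
    -- ones.
    have h := congrArg (fun t => X ◁ (β_ X Y).hom ≫ t ≫ (α_ X Y X).inv ≫ (β_ X Y).hom ▷ X ≫
      (α_ Y X X).hom ≫ Y ◁ (β_ X X).hom ≫ (α_ Y X X).inv) (yang_baxter X Y X)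
    have h1 := SymmetricCategory.symmetry X Y
    have h2 := SymmetricCategory.symmetry Y X
    have h3 := SymmetricCategory.symmetry X X
    simpa [← whiskerLeft_comp_assoc, ← comp_whiskerRight_assoc, ← whiskerLeft_comp,
      ← comp_whiskerRight, h1, h2, h3] using h
  have h1 := reassoc_of% (braiding_naturality_right X η)
  have h2 := braiding_naturality_right X ε
  simp only [whiskerLeft_comp, comp_whiskerRight, Category.assoc]
  rw [reassoc_of% key, h1, ← h2, reassoc_of% h]
  simp

end Learner

/-! ### Delays and the explicit form of the snake -/

namespace Learn
variable {C : Type u} [Category.{v} C] [MonoidalCategory C] [SymmetricCategory C]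
open Learner

/-- The learner `(A, A') ⟶ (A, A')` that delays `A` by one step: `P = Q = A`. -/
def fstDelay (X : Learn C) : X ⟶ X :=
  ofPair (P := X.fst) (Q := X.fst) (β_ X.fst X.fst).hom (𝟙 (X.fst ⊗ X.snd))

/-- The learner `(A, A') ⟶ (A, A')` that delays `A'` by one step: `P = Q = A'`. -/
def sndDelay (X : Learn C) : X ⟶ X :=
  ofPair (P := X.snd) (Q := X.snd) (𝟙 (X.snd ⊗ X.fst)) (β_ X.snd X.snd).hom

theorem ofHom_comp_eq_ofPair {X Y Z : Learn C} {F : X ⟶ Y} {G : Y ⟶ Z} {f : X.fst ⟶ Y.fst}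
    {g : Y.snd ⟶ X.snd} {P Q : C} {l : P ⊗ Y.fst ⟶ Q ⊗ Z.fst} {r : Q ⊗ Z.snd ⟶ P ⊗ Y.snd}
    (hF : F = ofHom f g) (hG : G = ofPair l r) : F ≫ G = ofPair (P ◁ f ≫ l) (r ≫ P ◁ g) := by
  rw [hF, hG, ofHom_comp_ofPair]

theorem comp_ofHom_eq_ofPair {X Y Z : Learn C} {F : X ⟶ Y} {G : Y ⟶ Z} {f : Y.fst ⟶ Z.fst}
    {g : Z.snd ⟶ Y.snd} {P Q : C} {l : P ⊗ X.fst ⟶ Q ⊗ Y.fst} {r : Q ⊗ Y.snd ⟶ P ⊗ X.snd}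
    (hF : F = ofPair l r) (hG : G = ofHom f g) : F ≫ G = ofPair (l ≫ Q ◁ f) (Q ◁ g ≫ r) := by
  rw [hF, hG, ofPair_comp_ofHom]

theorem comp_eq_ofPair {X Y Z : Learn C} {F : X ⟶ Y} {G : Y ⟶ Z} {P₁ Q₁ P₂ Q₂ : C}
    {l₁ : P₁ ⊗ X.fst ⟶ Q₁ ⊗ Y.fst} {r₁ : Q₁ ⊗ Y.snd ⟶ P₁ ⊗ X.snd}
    {l₂ : P₂ ⊗ Y.fst ⟶ Q₂ ⊗ Z.fst} {r₂ : Q₂ ⊗ Z.snd ⟶ P₂ ⊗ Y.snd}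
    (hF : F = ofPair l₁ r₁) (hG : G = ofPair l₂ r₂) :
    F ≫ G = ofPair (pcomp l₁ l₂) (pcomp r₂ r₁) := by
  rw [hF, hG, ofPair_comp_ofPair]

/-- Both components are cyclic permutations, so the snake delays `A` and `A'` by one step each. The
form is symmetric in the two components, which is what `star_snake` uses. -/
theorem snake_eq (X : Learn C) : snake X =
    ofPair (P := X.fst ⊗ X.snd) (Q := X.snd ⊗ X.fst)
      ((α_ X.fst X.snd X.fst).hom ≫ (β_ X.fst (X.snd ⊗ X.fst)).hom)
      ((α_ X.snd X.fst X.snd).hom ≫ (β_ X.snd (X.fst ⊗ X.snd)).hom) := by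
  have e1 : cup X ▷ X = ofPair (X := 𝟙_ (Learn C) ⊗ X) (Y := (X ⊗ X.dual) ⊗ X) _ _ :=
    ofPair_whiskerRight (X := 𝟙_ (Learn C)) (Y := X ⊗ X.dual) _ _ X
  have e2 : X ◁ cap X = ofPair (X := X ⊗ (X.dual ⊗ X)) (Y := X ⊗ 𝟙_ (Learn C)) _ _ :=
    whiskerLeft_ofPair X (X := X.dual ⊗ X) (Y := 𝟙_ (Learn C)) _ _
  have e3 : (ρ_ X).hom = _ := rightUnitor_hom X
  have e4 : (λ_ X).inv = ofHom (Y := 𝟙_ (Learn C) ⊗ X) (X := X) (λ_ X.fst).inv (ρ_ X.snd).hom := rfl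
  have e := ofHom_comp_eq_ofPair e4 (comp_eq_ofPair e1 (ofHom_comp_eq_ofPair
    (associator_hom X X.dual X) (comp_ofHom_eq_ofPair e2 e3)))
  -- The composite has parameters `I ⊗ (A ⊗ A')` and `I ⊗ (A' ⊗ A)`, the units being `P` of the cap
  -- and `Q` of the cup; the unitors slide them away.
  refine e.trans (ofPair_eq (λ_ (X.fst ⊗ X.snd)).hom (λ_ (X.snd ⊗ X.fst)).inv ?_ ?_)
  · change (𝟙_ C ⊗ (X.fst ⊗ X.snd)) ◁ (λ_ X.fst).inv ≫
      pcomp (wr ((ρ_ (X.fst ⊗ X.snd)).hom ≫ (λ_ (X.fst ⊗ X.snd)).inv) X.fst)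
        (𝟙_ C ◁ (α_ X.fst X.snd X.fst).hom ≫
          wl X.fst ((λ_ (X.snd ⊗ X.fst)).hom ≫ (ρ_ (X.snd ⊗ X.fst)).inv) ≫
            (X.snd ⊗ X.fst) ◁ (ρ_ X.fst).hom) = _
    simp [pcomp, wl, wr, exch]; monoidal
  · change _ = _ ≫ (pcomp (((X.snd ⊗ X.fst) ◁ (λ_ X.snd).inv ≫
          wr ((ρ_ (X.snd ⊗ X.fst)).hom ≫ (λ_ (X.snd ⊗ X.fst)).inv) X.snd) ≫
          𝟙_ C ◁ (α_ X.snd X.fst X.snd).hom)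
        (wl X.snd ((λ_ (X.fst ⊗ X.snd)).hom ≫ (ρ_ (X.fst ⊗ X.snd)).inv)) ≫
          (𝟙_ C ⊗ (X.fst ⊗ X.snd)) ◁ (ρ_ X.snd).hom) ≫ _
    simp [pcomp, wl, wr, exch]; monoidal

end Learn

/-! ### Wire permutations around a delayed map -/

namespace Learner
variable {C : Type u} [Category.{v} C] [MonoidalCategory C] [SymmetricCategory C]

theorem exch_braid (P X A : C) :
    (α_ P X A).hom ≫ exch P X A ≫ (β_ X (P ⊗ A)).hom =
      (α_ P X A).hom ≫ P ◁ (β_ X A).hom ≫ (α_ P A X).inv := by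
  simp [exch, ← comp_whiskerRight_assoc]

theorem braid_exch (P X A : C) :
    (β_ (P ⊗ A) X).hom ≫ exch X P A = (α_ P A X).hom ≫ P ◁ (β_ A X).hom := by
  simp [exch, ← comp_whiskerRight_assoc]

/-- With its input delayed, `r` reads only stored wires; the external `X` is merely routed into
storage. This is what makes `r` slidable. -/
theorem pcomp_braid_left {P Q X Y : C} (r : P ⊗ X ⟶ Q ⊗ Y) :
    pcomp (β_ X X).hom r = r ▷ X ≫ (β_ (Q ⊗ Y) X).hom ≫ (α_ X Q Y).inv := by
  rw [braiding_naturality_left_assoc]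
  simp [pcomp, exch]

/-- Dually, when its output is delayed, everything `r` produces goes into storage. -/
theorem pcomp_braid_right {P Q X Y : C} (r : P ⊗ X ⟶ Q ⊗ Y) :
    pcomp r (β_ Y Y).hom = ((α_ Y P X).hom ≫ (β_ Y (P ⊗ X)).hom) ≫ r ▷ Y := by
  rw [Category.assoc, ← braiding_naturality_right]
  simp [pcomp, exch]

theorem wl_eq_wr (Z : C) {P Q A B : C} (f : P ⊗ A ⟶ Q ⊗ B) :
    wl Z f = P ◁ (β_ Z A).hom ≫ wr f Z ≫ Q ◁ (β_ B Z).hom := by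
  rw [wr_braid, ← whiskerLeft_comp_assoc, SymmetricCategory.symmetry]
  simp

/-- The permutation exchanging the outer factors of `(U ⊗ X) ⊗ V`. -/
def outerSwap (U X V : C) : (U ⊗ X) ⊗ V ⟶ (V ⊗ X) ⊗ U :=
  (β_ U X).hom ▷ V ≫ (α_ X U V).hom ≫ X ◁ (β_ U V).hom ≫ (α_ X V U).inv ≫ (β_ X V).hom ▷ U

theorem outerSwap_nat (U V : C) {X Y : C} (f : X ⟶ Y) :
    (U ◁ f) ▷ V ≫ outerSwap U Y V = outerSwap U X V ≫ (V ◁ f) ▷ U := by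
  have h1 := congrArg (· ▷ V) (braiding_naturality_right U f)
  have h2 := congrArg (· ▷ U) (braiding_naturality_left f V)
  simp only [outerSwap, Category.assoc]
  simp only [comp_whiskerRight] at h1 h2
  rw [reassoc_of% h1, ← h2]
  simp only [associator_naturality_left_assoc, ← whisker_exchange_assoc,
    associator_inv_naturality_left_assoc]

/-- The permutations standing before `l` in `pcomp_exchange_delay`. Up to crossings of disjoint
wires, this is Yang–Baxter for `U`, `A`, `V`; `outerSwap_post` is the counterpart after `l`. -/
theorem outerSwap_pre (P A U V : C) :
    wl A ((β_ (P ⊗ U) V).hom ≫ (α_ V P U).inv) ≫ (α_ (V ⊗ P) A U).inv ≫ (α_ V P A).hom ▷ U =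
      (α_ (P ⊗ U) A V).inv ≫ ((α_ P U A).hom ≫ exch P U A) ▷ V ≫ outerSwap U (P ⊗ A) V := by
  rw [outerSwap, ← comp_whiskerRight_assoc, Category.assoc, exch_braid, wl_eq_wr]
  have hx := whisker_exchange (β_ P V).hom (β_ U A).hom
  have h := congrArg (fun t => (α_ P U (A ⊗ V)).hom ≫ P ◁ t ≫ (α_ P V (A ⊗ U)).inv ≫
    (β_ P V).hom ▷ (A ⊗ U) ≫ (α_ V P (A ⊗ U)).hom ≫ V ◁ (α_ P A U).inv ≫ (α_ V (P ⊗ A) U).inv) (yang_baxter U A V)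
  refine Eq.trans ?_ (h.symm.trans ?_)
  · simp only [whiskerLeft_comp, Category.assoc]
    rw [associator_inv_naturality_right_assoc, reassoc_of% hx]
    simp [wr]
  · simp

theorem outerSwap_post (Q B U V : C) :
    outerSwap U (Q ⊗ B) V ≫ (exch V Q B ≫ (α_ Q V B).inv) ▷ U ≫ (α_ (Q ⊗ V) B U).hom =
      (α_ U Q B).inv ▷ V ≫ (α_ (U ⊗ Q) B V).hom ≫
        wl B ((α_ U Q V).hom ≫ (β_ U (Q ⊗ V)).hom) := by
  rw [outerSwap, wl_eq_wr]
  simp only [Category.assoc, ← comp_whiskerRight_assoc, reassoc_of% (braid_exch Q V B)]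
  have hx := whisker_exchange (β_ U Q).hom (β_ B V).hom
  have h := congrArg (fun t => (α_ U Q B).inv ▷ V ≫ (α_ (U ⊗ Q) B V).hom ≫
    (β_ U Q).hom ▷ (B ⊗ V) ≫ (α_ Q U (B ⊗ V)).hom ≫ Q ◁ t ≫ (α_ Q V (B ⊗ U)).inv)
    (yang_baxter U B V)
  refine Eq.trans ?_ (h.trans ?_)
  · simp
  · simp only [whiskerLeft_comp, Category.assoc]
    rw [← associator_naturality_right_assoc, ← reassoc_of% hx]
    simp [wr]

/-- Each side is a single `l` between wire permutations. `outerSwap` carries `l` from one position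
to the other by naturality, and the remaining permutations agree. -/
theorem pcomp_exchange_delay {P Q A B U V : C} (l : P ⊗ A ⟶ Q ⊗ B) :
    wl A ((β_ (P ⊗ U) V).hom ≫ (α_ V P U).inv) ≫ wr (pcomp l (𝟙 (V ⊗ B))) U =
      wr (pcomp (𝟙 (U ⊗ A)) l) V ≫ wl B ((α_ U Q V).hom ≫ (β_ U (Q ⊗ V)).hom) := by
  have h1 : wr (pcomp l (𝟙 (V ⊗ B))) U = ((α_ (V ⊗ P) A U).inv ≫ (α_ V P A).hom ▷ U) ≫
      (V ◁ l) ▷ U ≫ (exch V Q B ≫ (α_ Q V B).inv) ▷ U ≫ (α_ (Q ⊗ V) B U).hom := by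
    simp [pcomp, wr]
  have h2 : wr (pcomp (𝟙 (U ⊗ A)) l) V = ((α_ (P ⊗ U) A V).inv ≫
      ((α_ P U A).hom ≫ exch P U A) ▷ V) ≫ (U ◁ l) ▷ V ≫ (α_ U Q B).inv ▷ V ≫
        (α_ (U ⊗ Q) B V).hom := by
    simp [pcomp, wr]
  have h3 := reassoc_of% (outerSwap_pre P A U V)
  have h4 := reassoc_of% (outerSwap_nat U V l)
  rw [h1, h2]
  simp only [Category.assoc] at h3 ⊢
  rw [h3, ← h4, outerSwap_post]

end Learner

namespace Learner
variable {C : Type u} [Category.{v} C] [MonoidalCategory C] [SymmetricCategory C]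

theorem wl_comp (X : C) {P Q R A B D : C} (f : P ⊗ A ⟶ Q ⊗ B) (g : Q ⊗ B ⟶ R ⊗ D) :
    wl X (f ≫ g) = wl X f ≫ wl X g := by
  simp [wl, reassoc_of% (exch_exch X Q B)]

theorem wl_id (X P A : C) : wl X (𝟙 (P ⊗ A)) = 𝟙 _ := by
  simp [wl, exch_exch]

end Learner

/-! ### Triviality of the delays modulo the congruence -/

namespace Learn
variable {C : Type u} [Category.{v} C] [MonoidalCategory C] [SymmetricCategory C]
open Learner

/-- Delaying the unit object does nothing, so one of the two delays in `snake_eq` drops out. -/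
theorem snake_unit_snd (A : C) : snake (⟨A, 𝟙_ C⟩ : Learn C) = fstDelay ⟨A, 𝟙_ C⟩ := by
  rw [snake_eq]
  refine ofPair_eq (ρ_ A).hom (λ_ A).inv ?_ ?_
  · change (α_ A (𝟙_ C) A).hom ≫ (β_ A (𝟙_ C ⊗ A)).hom =
      (ρ_ A).hom ▷ A ≫ (β_ A A).hom ≫ (λ_ A).inv ▷ A
    rw [← cancel_mono ((λ_ A).hom ▷ A), Category.assoc, ← braiding_naturality_right,
      triangle_assoc]
    simp only [Category.assoc, inv_hom_whiskerRight, Category.comp_id]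
  · change 𝟙 (A ⊗ 𝟙_ C) = (λ_ A).inv ▷ 𝟙_ C ≫
      ((α_ (𝟙_ C) A (𝟙_ C)).hom ≫ (β_ (𝟙_ C) (A ⊗ 𝟙_ C)).hom) ≫ (ρ_ A).hom ▷ 𝟙_ C
    simp

theorem fstDelay_eq (X : Learn C) :
    (fstDelay ⟨X.fst, 𝟙_ C⟩ ▷ ⟨𝟙_ C, X.snd⟩ : (⟨X.fst, 𝟙_ C⟩ : Learn C) ⊗ ⟨𝟙_ C, X.snd⟩ ⟶ _) ≫
        ofHom (X := ⟨X.fst, 𝟙_ C⟩ ⊗ ⟨𝟙_ C, X.snd⟩) (Y := X) (ρ_ X.fst).hom (ρ_ X.snd).inv =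
      ofHom (X := ⟨X.fst, 𝟙_ C⟩ ⊗ ⟨𝟙_ C, X.snd⟩) (Y := X) (ρ_ X.fst).hom (ρ_ X.snd).inv ≫
        fstDelay X := by
  refine nat_of_ofPair (X := ⟨X.fst, 𝟙_ C⟩ ⊗ ⟨𝟙_ C, X.snd⟩) (Y := ⟨X.fst, 𝟙_ C⟩ ⊗ ⟨𝟙_ C, X.snd⟩)
    (X' := X) (Y' := X) _ _ _ _ _ _ _ _ (wr_unit (β_ X.fst X.fst).hom) ?_
  change X.fst ◁ (ρ_ X.snd).inv ≫ wl X.snd (𝟙 (X.fst ⊗ 𝟙_ C)) = 𝟙 _ ≫ X.fst ◁ (ρ_ X.snd).inv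
  simp [wl, exch_exch]

/-- The delay on `(A, I)`, which is a snake, is tensored with `(I, A')` and conjugated by the
isomorphism `(A, I) ⊗ (I, A') ≅ (A, A')`. -/
theorem snakeRel_fstDelay (X : Learn C) : SnakeRel (fstDelay X) (𝟙 X) := by
  let e : (⟨X.fst, 𝟙_ C⟩ : Learn C) ⊗ ⟨𝟙_ C, X.snd⟩ ≅ X :=
    ofIso (X := ⟨X.fst, 𝟙_ C⟩ ⊗ ⟨𝟙_ C, X.snd⟩) (Y := X) (ρ_ X.fst) (ρ_ X.snd).symm
  have h1 : SnakeRel (fstDelay (⟨X.fst, 𝟙_ C⟩ : Learn C)) (𝟙 _) :=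
    snake_unit_snd X.fst ▸ SnakeRel.snake _
  have h2 := SnakeRel.comp (SnakeRel.refl e.inv) (SnakeRel.comp
    (SnakeRel.tensor h1 (SnakeRel.refl (𝟙 (⟨𝟙_ C, X.snd⟩ : Learn C)))) (SnakeRel.refl e.hom))
  rw [tensorHom_id, show _ ≫ e.hom = _ from fstDelay_eq X, id_tensorHom_id, Category.id_comp,
    e.inv_hom_id] at h2
  exact (e.inv_hom_id_assoc (fstDelay X)) ▸ h2

/-! ### The involution and its compatibility with the congruence -/

theorem star_comp {X Y Z : Learn C} (f : X ⟶ Y) (g : Y ⟶ Z) :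
    star (f ≫ g) = star g ≫ star f := by
  induction f using ind with
  | h P₁ Q₁ l₁ r₁ =>
  induction g using ind with
  | h P₂ Q₂ l₂ r₂ => rfl

theorem star_star {X Y : Learn C} (f : X ⟶ Y) : star (star f) = f := by
  induction f using ind with
  | h P Q l r => rfl

theorem star_whiskerRight {X Y : Learn C} (f : X ⟶ Y) (W : Learn C) :
    star (f ▷ W) = W.dual ◁ star f := by
  induction f using ind with
  | h P Q l r => rfl

theorem star_whiskerLeft (W : Learn C) {X Y : Learn C} (f : X ⟶ Y) :
    star (W ◁ f) = star f ▷ W.dual := by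
  induction f using ind with
  | h P Q l r => rfl

theorem star_snake (X : Learn C) : star (snake X) = snake X.dual := by
  rw [snake_eq, snake_eq]
  rfl

theorem SnakeRel.whiskerLeft (W : Learn C) {X Y : Learn C} {f g : X ⟶ Y} (h : SnakeRel f g) :
    SnakeRel (W ◁ f) (W ◁ g) := by
  simpa using (SnakeRel.refl (𝟙 W)).tensor h

theorem SnakeRel.whiskerRight {X Y : Learn C} {f g : X ⟶ Y} (h : SnakeRel f g) (W : Learn C) :
    SnakeRel (f ▷ W) (g ▷ W) := by
  simpa using h.tensor (SnakeRel.refl (𝟙 W))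

/-- The involution permutes the generating snakes and reverses both composition and tensor product.
-/
theorem SnakeRel.star {X Y : Learn C} {f g : X ⟶ Y} (h : SnakeRel f g) :
    SnakeRel (star f) (star g) := by
  induction h with
  | snake X => rw [star_snake]; exact SnakeRel.snake _
  | refl f => exact .refl _
  | symm _ ih => exact ih.symm
  | trans _ _ ih₁ ih₂ => exact ih₁.trans ih₂
  | comp _ _ ih₁ ih₂ => rw [star_comp, star_comp]; exact ih₂.comp ih₁
  | @tensor X Y Z W f f' g g' _ _ ih₁ ih₂ =>
    rw [MonoidalCategory.tensorHom_def, MonoidalCategory.tensorHom_def, star_comp, star_comp, star_whiskerRight, star_whiskerRight,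
      star_whiskerLeft, star_whiskerLeft]
    exact (ih₂.whiskerRight _).comp (ih₁.whiskerLeft _)

/-! ### Extranaturality of the cup and the cap -/

theorem cup_comp_whiskerRight {X Y : Learn C} {P Q : C} (l : P ⊗ X.fst ⟶ Q ⊗ Y.fst)
    (r : Q ⊗ Y.snd ⟶ P ⊗ X.snd) :
    cup X ≫ (ofPair l r : X ⟶ Y) ▷ X.dual =
      ofPair (X := 𝟙_ (Learn C)) (Y := Y ⊗ X.dual) (P := P ⊗ (X.fst ⊗ X.snd))
        ((ρ_ _).hom ≫ wr l X.snd) (wl X.fst r ≫ (ρ_ _).inv) := by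
  refine (comp_eq_ofPair (X := 𝟙_ (Learn C)) (Y := X ⊗ X.dual) (Z := Y ⊗ X.dual) rfl
    (ofPair_whiskerRight l r X.dual)).trans (ofPair_eq (𝟙 _) (λ_ Q).inv ?_ ?_)
  · change pcomp ((ρ_ (X.fst ⊗ X.snd)).hom ≫ (λ_ (X.fst ⊗ X.snd)).inv) (wr l X.snd) =
      _ ▷ 𝟙_ C ≫ ((ρ_ (P ⊗ (X.fst ⊗ X.snd))).hom ≫ wr l X.snd) ≫ _ ▷ (Y.fst ⊗ X.snd)
    simp [pcomp, exch_unit_mid]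
  · change wl X.fst r ≫ (ρ_ (P ⊗ (X.fst ⊗ X.snd))).inv = _ ▷ (X.fst ⊗ Y.snd) ≫
      pcomp (wl X.fst r) ((λ_ (X.fst ⊗ X.snd)).hom ≫ (ρ_ (X.fst ⊗ X.snd)).inv) ≫ _ ▷ 𝟙_ C
    simp [pcomp, exch_unit_left]

/-- The cup consists of unitors, so it only turns the inputs of the left component into parameters.
Compared with `cup_comp_whiskerRight`, `l` and `r` have changed sides. -/
theorem cup_comp_whiskerLeft {X Y : Learn C} {P Q : C} (l : P ⊗ X.fst ⟶ Q ⊗ Y.fst)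
    (r : Q ⊗ Y.snd ⟶ P ⊗ X.snd) :
    cup Y ≫ Y ◁ star (ofPair l r : X ⟶ Y) =
      ofPair (X := 𝟙_ (Learn C)) (Y := Y ⊗ X.dual) (P := Q ⊗ (Y.fst ⊗ Y.snd))
        ((ρ_ _).hom ≫ wl Y.fst r) (wr l Y.snd ≫ (ρ_ _).inv) := by
  refine (comp_eq_ofPair (X := 𝟙_ (Learn C)) (Y := Y ⊗ Y.dual) (Z := Y ⊗ X.dual) rfl
    (whiskerLeft_ofPair Y (X := Y.dual) (Y := X.dual) r l)).trans
      (ofPair_eq (𝟙 _) (λ_ P).inv ?_ ?_)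
  · change pcomp ((ρ_ (Y.fst ⊗ Y.snd)).hom ≫ (λ_ (Y.fst ⊗ Y.snd)).inv) (wl Y.fst r) =
      _ ▷ 𝟙_ C ≫ ((ρ_ (Q ⊗ (Y.fst ⊗ Y.snd))).hom ≫ wl Y.fst r) ≫ _ ▷ (Y.fst ⊗ X.snd)
    simp [pcomp, exch_unit_mid]
  · change wr l Y.snd ≫ (ρ_ (Q ⊗ (Y.fst ⊗ Y.snd))).inv = _ ▷ (X.fst ⊗ Y.snd) ≫
      pcomp (wr l Y.snd) ((λ_ (Y.fst ⊗ Y.snd)).hom ≫ (ρ_ (Y.fst ⊗ Y.snd)).inv) ≫ _ ▷ 𝟙_ C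
    simp [pcomp, exch_unit_left]

/-- An equality of learners, prior to any quotient: the delays free `r` from the external wires, so
two slides in the coend suffice, first of `r` to the left, then of `l` to the right. -/
theorem cup_extranatural_delay {X Y : Learn C} (f : X ⟶ Y) :
    cup X ≫ (f ≫ sndDelay Y) ▷ X.dual = cup Y ≫ Y ◁ star (sndDelay X ≫ f) := by
  induction f using ind with
  | h P Q l r =>
    -- `s` is the rewiring left in the right component once `r` has been slid away; its inverse `s'`
    -- is absorbed into the second slide.
    let s : (P ⊗ X.snd) ⊗ Y.snd ⟶ (Y.snd ⊗ P) ⊗ X.snd :=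
      (β_ (P ⊗ X.snd) Y.snd).hom ≫ (α_ Y.snd P X.snd).inv
    let s' : (Y.snd ⊗ P) ⊗ X.snd ⟶ (P ⊗ X.snd) ⊗ Y.snd :=
      (α_ Y.snd P X.snd).hom ≫ (β_ Y.snd (P ⊗ X.snd)).hom
    have hs : s ≫ s' = 𝟙 _ := by simp [s, s', -braiding_tensor_left_hom, -braiding_tensor_right_hom]
    have hs' : s' ≫ s = 𝟙 _ := by simp [s, s', -braiding_tensor_left_hom, -braiding_tensor_right_hom]
    have h1 : wl X.fst (pcomp (β_ Y.snd Y.snd).hom r) = r ▷ (X.fst ⊗ Y.snd) ≫ wl X.fst s := by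
      rw [pcomp_braid_left]
      rw [← Category.comp_id (wl X.fst s), ← id_whiskerRight, ← wl_nat, id_whiskerRight,
        Category.comp_id]
    have h2 : wl Y.fst (pcomp r (β_ X.snd X.snd).hom) =
        wl Y.fst ((α_ X.snd Q Y.snd).hom ≫ (β_ X.snd (Q ⊗ Y.snd)).hom) ≫
          r ▷ (Y.fst ⊗ X.snd) := by
      rw [pcomp_braid_right]
      simpa only [id_whiskerRight, Category.id_comp] using wl_nat Y.fst
        ((α_ X.snd Q Y.snd).hom ≫ (β_ X.snd (Q ⊗ Y.snd)).hom) (𝟙 _) r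
    have h3 : wr (pcomp l (𝟙 (Y.snd ⊗ Y.fst))) X.snd ≫ r ▷ (Y.fst ⊗ X.snd) =
        (wl X.fst s' ≫ wr (pcomp (𝟙 (X.snd ⊗ X.fst)) l) Y.snd) ≫
          wl Y.fst (pcomp r (β_ X.snd X.snd).hom) := by
      have h := reassoc_of% (pcomp_exchange_delay (U := X.snd) (V := Y.snd) l)
      rw [h2, Category.assoc, ← h, ← Category.assoc (wl X.fst s'), ← wl_comp, hs', wl_id,
        Category.id_comp]
    have h4 : wr (pcomp (𝟙 (X.snd ⊗ X.fst)) l) Y.snd =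
        wl X.fst s ≫ wl X.fst s' ≫ wr (pcomp (𝟙 (X.snd ⊗ X.fst)) l) Y.snd := by
      rw [← Category.assoc (wl X.fst s), ← wl_comp, hs, wl_id, Category.id_comp]
    refine (cup_comp_whiskerRight (pcomp l (𝟙 (Y.snd ⊗ Y.fst)))
      (pcomp (β_ Y.snd Y.snd).hom r)).trans (Eq.trans ?_ (cup_comp_whiskerLeft
        (pcomp (𝟙 (X.snd ⊗ X.fst)) l) (pcomp r (β_ X.snd X.snd).hom)).symm)
    -- The halfway learner: `l` followed by `r` on the left, bare rewiring on the right.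
    trans ofPair (X := 𝟙_ (Learn C)) (Y := Y ⊗ X.dual) (P := (Y.snd ⊗ P) ⊗ (X.fst ⊗ X.snd))
      (Q := P ⊗ X.snd)
      ((ρ_ _).hom ≫ wr (pcomp l (𝟙 (Y.snd ⊗ Y.fst))) X.snd ≫ r ▷ (Y.fst ⊗ X.snd))
      (wl X.fst s ≫ (ρ_ _).inv)
    · refine (ofPair_eq (𝟙 _) r ?_ ?_).symm
      · change _ = _ ▷ 𝟙_ C ≫
          ((ρ_ _).hom ≫ wr (pcomp l (𝟙 (Y.snd ⊗ Y.fst))) X.snd) ≫ r ▷ (Y.fst ⊗ X.snd)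
        rw [id_whiskerRight, Category.id_comp, Category.assoc]
        rfl
      · change _ = r ▷ (X.fst ⊗ Y.snd) ≫ (wl X.fst s ≫ (ρ_ _).inv) ≫ _ ▷ 𝟙_ C
        rw [h1, id_whiskerRight, Category.comp_id]
        exact Category.assoc _ _ _
    -- By `h3` the left component begins with this map on parameters; slid to the right, its `s'`
    -- cancels `s` (`h4`).
    · refine ofPair_eq (wl X.fst s' ≫ wr (pcomp (𝟙 (X.snd ⊗ X.fst)) l) Y.snd) (𝟙 _) ?_ ?_
      · change _ = _ ▷ 𝟙_ C ≫ ((ρ_ _).hom ≫ wl Y.fst (pcomp r (β_ X.snd X.snd).hom)) ≫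
          _ ▷ (Y.fst ⊗ X.snd)
        rw [id_whiskerRight, Category.comp_id, rightUnitor_naturality_assoc, ← h3]
        rfl
      · change wr (pcomp (𝟙 (X.snd ⊗ X.fst)) l) Y.snd ≫ (ρ_ _).inv =
          _ ▷ (X.fst ⊗ Y.snd) ≫ (wl X.fst s ≫ (ρ_ _).inv) ≫ _ ▷ 𝟙_ C
        rw [id_whiskerRight, Category.id_comp, Category.assoc, ← rightUnitor_inv_naturality,
          ← Category.assoc, ← h4]

theorem snakeRel_sndDelay (X : Learn C) : SnakeRel (sndDelay X) (𝟙 X) :=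
  (snakeRel_fstDelay X.dual).star

theorem snakeRel_cup {X Y : Learn C} (f : X ⟶ Y) :
    SnakeRel (cup X ≫ f ▷ X.dual) (cup Y ≫ Y ◁ star f) := by
  have h₁ : SnakeRel (f ≫ sndDelay Y) f := by
    simpa using (SnakeRel.refl f).comp (snakeRel_sndDelay Y)
  have h₂ : SnakeRel (sndDelay X ≫ f) f := by
    simpa using (snakeRel_sndDelay X).comp (SnakeRel.refl f)
  have h₃ := (SnakeRel.refl (cup X)).comp (h₁.whiskerRight X.dual)
  rw [cup_extranatural_delay] at h₃
  exact h₃.symm.trans ((SnakeRel.refl (cup Y)).comp (h₂.star.whiskerLeft Y))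

/-- The image under the involution of `snakeRel_cup` for `star f`, since `star (cup X.dual)` is `cap
X` by definition. -/
theorem snakeRel_cap {X Y : Learn C} (f : X ⟶ Y) :
    SnakeRel (star f ▷ X ≫ cap X) (Y.dual ◁ f ≫ cap Y) := by
  have h := (snakeRel_cup (star f)).symm.star
  rwa [star_comp, star_comp, star_whiskerRight, star_whiskerLeft, star_star,
    star_star] at h

/-- The crossing on the output can be absorbed into the parameter `A ⊗ A'`; sliding it across
cancels the crossing in the other component. -/
theorem cup_braid (X : Learn C) : cup X ≫ (β_ X X.dual).hom = cup X.dual := by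
  refine (comp_ofHom_eq_ofPair (X := 𝟙_ (Learn C)) (Y := X ⊗ X.dual) (Z := X.dual ⊗ X) rfl
    (braid_hom X X.dual)).trans (ofPair_eq (β_ X.fst X.snd).hom (𝟙 _) ?_ ?_)
  · change ((ρ_ (X.fst ⊗ X.snd)).hom ≫ (λ_ (X.fst ⊗ X.snd)).inv) ≫ _ ◁ (β_ X.fst X.snd).hom =
      _ ▷ 𝟙_ C ≫ ((ρ_ (X.snd ⊗ X.fst)).hom ≫ (λ_ (X.snd ⊗ X.fst)).inv) ≫ _ ▷ (X.snd ⊗ X.fst)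
    simp
  · change (λ_ (X.snd ⊗ X.fst)).hom ≫ (ρ_ (X.snd ⊗ X.fst)).inv = _ ▷ (X.snd ⊗ X.fst) ≫
      (_ ◁ (β_ X.snd X.fst).hom ≫ (λ_ (X.fst ⊗ X.snd)).hom ≫ (ρ_ (X.fst ⊗ X.snd)).inv) ≫
        (β_ X.fst X.snd).hom ▷ 𝟙_ C
    simp

theorem braid_cap (X : Learn C) : (β_ X X.dual).hom ≫ cap X = cap X.dual := by
  have h := congrArg star (cup_braid X.dual)
  rwa [star_comp] at h

end Learn

/-! ### Duals in the quotient -/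

namespace Atemp
variable {C : Type u} [Category.{v} C] [MonoidalCategory C] [SymmetricCategory C]

theorem snake_fst (X : Learn C) :
    cup X ▷ of X ≫ (α_ (of X) (of X.dual) (of X)).hom ≫ of X ◁ cap X =
      (λ_ (of X)).hom ≫ (ρ_ (of X)).inv := by
  have h : (λ_ (of X)).inv ≫ cup X ▷ of X ≫ (α_ (of X) (of X.dual) (of X)).hom ≫ of X ◁ cap X ≫
      (ρ_ (of X)).hom = 𝟙 (of X) := proj_sound (Learn.SnakeRel.snake X)
  rw [Iso.eq_comp_inv, ← Iso.inv_comp_eq_id]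
  simpa using h

theorem cup_extranatural {X Y : Learn C} (f : X ⟶ Y) :
    cup X ≫ (proj C).map f ▷ of X.dual = cup Y ≫ of Y ◁ (proj C).map (Learn.star f) :=
  proj_sound (Learn.snakeRel_cup f)

theorem cap_extranatural {X Y : Learn C} (f : X ⟶ Y) :
    (proj C).map (Learn.star f) ▷ of X ≫ cap X = of Y.dual ◁ (proj C).map f ≫ cap Y :=
  proj_sound (Learn.snakeRel_cap f)

theorem snake_snd (X : Learn C) :
    of X.dual ◁ cup X ≫ (α_ (of X.dual) (of X) (of X.dual)).inv ≫ cap X ▷ of X.dual =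
      (ρ_ (of X.dual)).hom ≫ (λ_ (of X.dual)).inv :=
  -- `X.dual.dual` is `X` definitionally, so the reflected snake of `X.dual` has the required type.
  Learner.snake_braided (snake_fst X.dual) (congrArg (proj C).map (Learn.cup_braid X.dual))
    (congrArg (proj C).map (Learn.braid_cap X.dual))

/-- The cup and the cap of `X` exhibit `X.dual` as a dual of `X`. -/
@[reducible]
def exactPairing (X : Learn C) : ExactPairing (of X) (of X.dual) where
  coevaluation' := cup X
  evaluation' := cap X
  coevaluation_evaluation' := snake_snd X
  evaluation_coevaluation' := snake_fst X

/-- Every object `(A, A')` of the category of atemporal learners has the right dual `(A', A)`. -/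
@[reducible]
def rightRigidCategory : RightRigidCategory (Atemp C) where
  rightDual X :=
    { rightDual := of X.as.dual
      exact := exactPairing X.as }

end Atemp

theorem mainTheorem3 (C : Type u) [Category.{v} C] [MonoidalCategory C] [SymmetricCategory C] :
    -- every object has a left and a right dual
    Nonempty (RigidCategory (Atemp C)) ∧
    -- the cup and the cap exhibit `(A', A)` as the dual of `(A, A')`
    (∀ X : Learn C, ∃ e : ExactPairing (Atemp.of X) (Atemp.of X.dual),
      e.coevaluation' = Atemp.cup X ∧ e.evaluation' = Atemp.cap X) ∧
    -- the cup and the cap are extranatural, the dual of a morphism `(l | r)` being `(r | l)`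
    (∀ (X Y : Learn C) (f : X ⟶ Y),
      Atemp.cup X ≫ (Atemp.proj C).map f ▷ Atemp.of X.dual =
          Atemp.cup Y ≫ Atemp.of Y ◁ (Atemp.proj C).map (Learn.star f) ∧
        (Atemp.proj C).map (Learn.star f) ▷ Atemp.of X ≫ Atemp.cap X =
          Atemp.of Y.dual ◁ (Atemp.proj C).map f ≫ Atemp.cap Y) := by
  refine ⟨⟨?_⟩, fun X => ⟨Atemp.exactPairing X, rfl, rfl⟩,
    fun X Y f => ⟨Atemp.cup_extranatural f, Atemp.cap_extranatural f⟩⟩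
  letI : RightRigidCategory (Atemp C) := Atemp.rightRigidCategory
  -- The symmetry turns right duals into left duals.
  exact BraidedCategory.rigidCategoryOfRightRigidCategory
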